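/- Let $K$ be an algebraically closed field. Quivers are finite, paths are written from left to right, and $R$ denotes the two-sided ideal of the path algebra $KQ$ generated by the arrows. An ideal $I$ of $KQ$ is admissible if $R^n\subseteq I\subseteq R^2$ for some $n\ge 2$. Call $KQ/I$, with $I$ admissible, a *special biserial bound quiver algebra* if (S0) at every vertex of $Q$ at most two arrows start and at most two arrows end, and (S1) for every arrow $\alpha$ there is at most one arrow $\beta$ starting where $\alpha$ ends with $\alpha\beta\notin I$, and at most one arrow $\gamma$ ending where $\alpha$ starts with $\gamma\alpha\notin I$. A finite-dimensional $K$-algebra is *special biserial* if it is Morita equivalent (over $K$) to such an algebra $KQ/I$. A *Brauer graph* $G$ is a finite graph (loops and multiple edges allowed) with a multiplicity $m(v)\in\mathbb Z_{>0}$ at each vertex $v$ and a cyclic ordering of the half-edges at each vertex; it is not required to be connected here. Let $\mathrm{val}(v)$ be the number of half-edges at $v$; an edge is truncated at its end $v$ if $m(v)\,\mathrm{val}(v)=1$. The quiver $Q_G$ has the edges of $G$ as vertices, and for each half-edge $h$ at a vertex $v$ with $m(v)\,\mathrm{val}(v)\ne 1$ it has one arrow from the edge of $h$ to the edge of the successor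 of $h$. For each such half-edge, starting with its arrow and following the cyclic ordering once around $v$ gives a special cycle $C_v$ of length $\mathrm{val}(v)$; it is a special $i$-cycle if $h$ belongs to the edge $i$. The *Brauer graph algebra* is $A_G=KQ_G/I_G$, where $I_G$ is the two-sided ideal generated by * (I) $C_v^{m(v)}-C_{v'}^{m(v')}$ for all edges $i$ and all special $i$-cycles $C_v,C_{v'}$; * (II) $C_v^{m(v)}\alpha_1$ for every special cycle $C_v=\alpha_1\alpha_2\cdots\alpha_n$; * (III) $\alpha\beta$ for all composable arrows $\alpha,\beta$ such that $\alpha\beta$ is not a subpath of any special cycle, except when $\alpha=\beta$ is the loop at a vertex $v$ with $\mathrm{val}(v)=1$ and $m(v)>1$. By convention, an edge truncated at both of its ends contributes in addition one loop $x$ with the relation $x^2$, so that its component has algebra $K[x]/(x^2)$. **Corollary.** Every special biserial algebra is a quotient of a Brauer graph algebra. Precisely: 1. If $KQ/I$ is a special biserial bound quiver algebra, then there are a Brauer graph $G$ and a surjective $K$-algebra homomorphism $A_G\to KQ/I$. If $KQ/I$ is indecomposable as an algebra, $G$ can be chosen connected. 2. If $A$ is any special biserial $K$-algebra, then there are a Brauer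 graph $G$, a finite-dimensional $K$-algebra $B$ Morita equivalent (over $K$) to $A_G$, and a surjective $K$-algebra homomorphism $B\to A$. If $A$ is indecomposable as an algebra, $G$ can be chosen connected. -/

import Mathlib

universe u v w

noncomputable section

/-! ### Path algebras -/

/-- The path algebra `K V` of a quiver on the vertex set `V`: the vector space whose basis is the set
of all paths, including a trivial path at each vertex. -/
def PathAlgebra (K : Type v) (V : Type u) [CommRing K] [Quiver.{w} V] : Type (max u v w) :=
  (Σ a b : V, Quiver.Path a b) →₀ K

namespace PathAlgebra

variable {K : Type v} {V : Type u} [CommRing K] [Quiver.{w} V]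

instance : AddCommGroup (PathAlgebra K V) :=
  inferInstanceAs (AddCommGroup ((Σ a b : V, Quiver.Path a b) →₀ K))

instance : Module K (PathAlgebra K V) :=
  inferInstanceAs (Module K ((Σ a b : V, Quiver.Path a b) →₀ K))

/-- A path, as a basis element of the path algebra. -/
def ofPath {a b : V} (p : Quiver.Path a b) : PathAlgebra K V :=
  Finsupp.single (⟨a, b, p⟩ : Σ a b : V, Quiver.Path a b) (1 : K)

/-- An arrow, as an element of the path algebra. -/
def ofArrow {a b : V} (α : a ⟶ b) : PathAlgebra K V :=
  ofPath α.toPath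

open Classical in
/-- The product of two paths: their concatenation `p q` (first `p`, then `q`) if `p` ends where
`q` starts, and zero otherwise. -/
def pathMul (p q : Σ a b : V, Quiver.Path a b) : PathAlgebra K V :=
  if h : p.2.1 = q.1 then ofPath (p.2.2.comp (q.2.2.cast h.symm rfl)) else 0

/-- The multiplication of the path algebra: the bilinear extension of `pathMul`. -/
def mulHom : PathAlgebra K V →ₗ[K] PathAlgebra K V →ₗ[K] PathAlgebra K V :=
  Finsupp.linearCombination K (M := PathAlgebra K V →ₗ[K] PathAlgebra K V)
    fun p => Finsupp.linearCombination K (M := PathAlgebra K V) fun q => pathMul p q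

instance : Mul (PathAlgebra K V) := ⟨fun x y => mulHom x y⟩

instance [Fintype V] : One (PathAlgebra K V) :=
  ⟨∑ a : V, ofPath (Quiver.Path.nil : Quiver.Path a a)⟩

theorem mul_def (x y : PathAlgebra K V) : x * y = mulHom x y := rfl

theorem one_def [Fintype V] :
    (1 : PathAlgebra K V) = ∑ a : V, ofPath (Quiver.Path.nil : Quiver.Path a a) := rfl

theorem mulHom_ofPath {a b c d : V} (p : Quiver.Path a b) (q : Quiver.Path c d) :
    mulHom (K := K) (ofPath p) (ofPath q) = pathMul ⟨a, b, p⟩ ⟨c, d, q⟩ := by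
  have h : mulHom (K := K) (ofPath p) = Finsupp.linearCombination K (M := PathAlgebra K V)
      fun q => pathMul (⟨a, b, p⟩ : Σ a b : V, Quiver.Path a b) q :=
    (Finsupp.linearCombination_single K (M := PathAlgebra K V →ₗ[K] PathAlgebra K V) 1
      (⟨a, b, p⟩ : Σ a b : V, Quiver.Path a b)).trans (one_smul K _)
  rw [h]
  exact (Finsupp.linearCombination_single K (M := PathAlgebra K V) 1
    (⟨c, d, q⟩ : Σ a b : V, Quiver.Path a b)).trans (one_smul K _)

theorem ofPath_mul_ofPath {a b c : V} (p : Quiver.Path a b) (q : Quiver.Path b c) :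
    (ofPath p * ofPath q : PathAlgebra K V) = ofPath (p.comp q) := by
  rw [mul_def, mulHom_ofPath, pathMul, dif_pos rfl]
  rfl

theorem ofPath_mul_ofPath_of_ne {a b c d : V} (p : Quiver.Path a b) (q : Quiver.Path c d)
    (h : b ≠ c) : (ofPath p * ofPath q : PathAlgebra K V) = 0 := by
  rw [mul_def, mulHom_ofPath, pathMul, dif_neg h]

/-- Two linear maps on the path algebra that agree on all paths are equal. -/
theorem linearMap_ext {M : Type*} [AddCommGroup M] [Module K M]
    {f g : PathAlgebra K V →ₗ[K] M}
    (h : ∀ (a b : V) (p : Quiver.Path a b), f (ofPath p) = g (ofPath p)) : f = g :=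
  Finsupp.lhom_ext' fun ⟨a, b, p⟩ => LinearMap.ext_ring (h a b p)

theorem ofPath_mul_assoc {a b c d e f : V} (p : Quiver.Path a b) (q : Quiver.Path c d)
    (r : Quiver.Path e f) :
    (ofPath p * ofPath q * ofPath r : PathAlgebra K V) = ofPath p * (ofPath q * ofPath r) := by
  by_cases h₁ : b = c
  · subst h₁
    by_cases h₂ : d = e
    · subst h₂
      simp only [ofPath_mul_ofPath, Quiver.Path.comp_assoc]
    · rw [ofPath_mul_ofPath, ofPath_mul_ofPath_of_ne _ _ h₂, ofPath_mul_ofPath_of_ne _ _ h₂]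
      exact (map_zero (mulHom (ofPath p))).symm
  · rw [ofPath_mul_ofPath_of_ne _ _ h₁]
    by_cases h₂ : d = e
    · subst h₂
      rw [ofPath_mul_ofPath, ofPath_mul_ofPath_of_ne _ _ h₁]
      exact LinearMap.map_zero₂ mulHom (ofPath r)
    · rw [ofPath_mul_ofPath_of_ne _ _ h₂]
      exact (LinearMap.map_zero₂ mulHom (ofPath r)).trans (map_zero (mulHom (ofPath p))).symm

theorem mul_assoc_aux (x y z : PathAlgebra K V) : x * y * z = x * (y * z) := by
  have h : (mulHom.flip z).comp (mulHom.flip y) = mulHom.flip (mulHom (K := K) y z) := by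
    refine linearMap_ext fun a b p => ?_
    have h' : (mulHom.flip z).comp (mulHom (ofPath p)) =
        (mulHom (K := K) (ofPath p)).comp (mulHom.flip z) := by
      refine linearMap_ext fun c d q => ?_
      have h'' : mulHom (mulHom (ofPath p) (ofPath q)) =
          (mulHom (K := K) (ofPath p)).comp (mulHom (ofPath q)) :=
        linearMap_ext fun e f r => ofPath_mul_assoc p q r
      exact LinearMap.congr_fun h'' z
    exact LinearMap.congr_fun h' y
  exact LinearMap.congr_fun h x

theorem one_mul_aux [Fintype V] (x : PathAlgebra K V) : 1 * x = x := by
  have h : mulHom (1 : PathAlgebra K V) = LinearMap.id := by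
    refine linearMap_ext fun a b p => ?_
    rw [one_def, map_sum, LinearMap.sum_apply, Finset.sum_eq_single a]
    · exact (ofPath_mul_ofPath _ p).trans (by rw [Quiver.Path.nil_comp]; rfl)
    · exact fun c _ hc => ofPath_mul_ofPath_of_ne _ p hc
    · exact fun ha => absurd (Finset.mem_univ a) ha
  exact LinearMap.congr_fun h x

theorem mul_one_aux [Fintype V] (x : PathAlgebra K V) : x * 1 = x := by
  have h : (mulHom (K := K) (V := V)).flip 1 = LinearMap.id := by
    refine linearMap_ext fun a b p => ?_
    rw [LinearMap.flip_apply, one_def, map_sum, Finset.sum_eq_single b]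
    · exact (ofPath_mul_ofPath p _).trans (by rw [Quiver.Path.comp_nil]; rfl)
    · exact fun c _ hc => ofPath_mul_ofPath_of_ne p _ (Ne.symm hc)
    · exact fun ha => absurd (Finset.mem_univ b) ha
  exact LinearMap.congr_fun h x

instance [Fintype V] : Ring (PathAlgebra K V) :=
  { (inferInstance : AddCommGroup (PathAlgebra K V)) with
    mul := (· * ·)
    one := 1
    left_distrib := fun x y z => map_add (mulHom x) y z
    right_distrib := fun x y z => LinearMap.map_add₂ mulHom x y z
    zero_mul := fun x => LinearMap.map_zero₂ mulHom x
    mul_zero := fun x => map_zero (mulHom x)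
    mul_assoc := mul_assoc_aux
    one_mul := one_mul_aux
    mul_one := mul_one_aux }

instance [Fintype V] : Algebra K (PathAlgebra K V) :=
  Algebra.ofModule (fun r x y => LinearMap.map_smul₂ mulHom r x y)
    (fun r x y => map_smul (mulHom x) r y)

variable (K V) in
/-- The two-sided ideal of the path algebra generated by the arrows. -/
def arrowIdeal [Fintype V] : Ideal (PathAlgebra K V) :=
  (TwoSidedIdeal.span {x | ∃ (a b : V) (α : a ⟶ b), x = ofArrow α}).asIdeal

/-- An ideal `I` is admissible if `R ^ n ⊆ I ⊆ R ^ 2` for some `n ≥ 2`, where `R` is the ideal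
generated by the arrows. -/
def IsAdmissible [Fintype V] (I : Ideal (PathAlgebra K V)) : Prop :=
  ∃ n : ℕ, 2 ≤ n ∧ arrowIdeal K V ^ n ≤ I ∧ I ≤ arrowIdeal K V ^ 2

variable (V) in
/-- (S0): at most two arrows start and at most two arrows end at every vertex. -/
def ConditionS0 : Prop :=
  ∀ a : V, ENat.card (Σ b : V, a ⟶ b) ≤ 2 ∧ ENat.card (Σ b : V, b ⟶ a) ≤ 2

/-- (S1): for every arrow `α` there is at most one arrow `β` with `α β ∉ I` and at most one arrow
`γ` with `γ α ∉ I`. -/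
def ConditionS1 [Fintype V] (I : Ideal (PathAlgebra K V)) : Prop :=
  ∀ (a b : V) (α : a ⟶ b),
    {β : Σ c : V, b ⟶ c | (ofArrow α * ofArrow β.2 : PathAlgebra K V) ∉ I}.Subsingleton ∧
    {γ : Σ c : V, c ⟶ a | (ofArrow γ.2 * ofArrow α : PathAlgebra K V) ∉ I}.Subsingleton

/-- The two-sided ideal `I` is admissible and the bound quiver algebra `K V / I` satisfies
(S0) and (S1). -/
structure IsSpecialBiserialIdeal [Fintype V] (I : Ideal (PathAlgebra K V)) : Prop where
  isAdmissible : IsAdmissible I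
  conditionS0 : ConditionS0 V
  conditionS1 : ConditionS1 I

end PathAlgebra

/-! ### Special biserial algebras -/

/-- A finite dimensional `K`-algebra `A` is special biserial if it is Morita equivalent to some
`K Q / I` with `Q` a finite quiver and `I` an admissible ideal such that (S0) and (S1) hold. -/
def IsSpecialBiserial (K : Type v) [Field K] (A : Type u) [Ring A] [Algebra K A] : Prop :=
  Module.Finite K A ∧
    ∃ (Q : Type) (_ : Fintype Q) (_ : Quiver.{0} Q) (I : Ideal (PathAlgebra K Q))
      (_ : I.IsTwoSided),
      PathAlgebra.IsSpecialBiserialIdeal I ∧ IsMoritaEquivalent K A (PathAlgebra K Q ⧸ I)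

/-- A ring is indecomposable if it is nonzero and is not the product of two nonzero rings: its
only central idempotents are `0` and `1`. -/
def IsIndecomposableRing (A : Type u) [Ring A] : Prop :=
  Nontrivial A ∧ ∀ e ∈ Subring.center A, IsIdempotentElem e → e = 0 ∨ e = 1

/-! ### Brauer graphs -/

/-- A Brauer graph: a finite graph, possibly with loops and multiple edges, with a multiplicity
at each vertex and a cyclic ordering of the half-edges at each vertex.

The half-edges are the pairs `(i, x)` with `i` an edge and `x : Bool` one of its two ends. The
cyclic orderings are recorded by the permutation `succ` that takes a half-edge to its successor;
its cycles are the sets of half-edges at the vertices. Connectedness is the separate predicate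
`BrauerGraph.IsConnected`. -/
structure BrauerGraph where
  Vertex : Type
  Edge : Type
  [fintypeVertex : Fintype Vertex]
  [fintypeEdge : Fintype Edge]
  vertexOf : Edge × Bool → Vertex
  mult : Vertex → ℕ
  mult_pos : ∀ v, 0 < mult v
  succ : Equiv.Perm (Edge × Bool)
  sameCycle_succ_iff : ∀ h h', succ.SameCycle h h' ↔ vertexOf h = vertexOf h'

namespace BrauerGraph

attribute [instance] fintypeVertex fintypeEdge

variable (G : BrauerGraph)

/-- The underlying graph is connected (in particular it has a vertex). -/
def IsConnected : Prop :=
  (SimpleGraph.fromRel fun v w : G.Vertex =>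
    ∃ i : G.Edge, G.vertexOf (i, false) = v ∧ G.vertexOf (i, true) = w).Connected

/-- The valency of a vertex: the number of half-edges at it, so that a loop counts twice. -/
def val (v : G.Vertex) : ℕ := Nat.card {h : G.Edge × Bool // G.vertexOf h = v}

/-- The edge `h.1` is truncated at the vertex of its half-edge `h`. -/
def IsTruncated (h : G.Edge × Bool) : Prop :=
  G.mult (G.vertexOf h) * G.val (G.vertexOf h) = 1

theorem vertexOf_succ (h : G.Edge × Bool) : G.vertexOf (G.succ h) = G.vertexOf h :=
  ((G.sameCycle_succ_iff h (G.succ h)).1 (Equiv.Perm.SameCycle.refl _ _).apply_right).symm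

/-- The half-edges at which the edge is not truncated. -/
def FullHalfEdge : Type := {h : G.Edge × Bool // ¬ G.IsTruncated h}

/-- The successor of a non-truncated half-edge. -/
def next (h : G.FullHalfEdge) : G.FullHalfEdge :=
  ⟨G.succ h.1, by
    have := h.2
    unfold IsTruncated at this ⊢
    rwa [G.vertexOf_succ]⟩

/-- The arrows of the quiver of `G`. A non-truncated half-edge `h` gives an arrow from its edge to
the edge of its successor. An edge that is truncated at both ends forms a connected component by
itself, whose algebra is by convention `K[x]/(x²)`: it gives one loop `x`. -/
inductive Arrow : Type
  | ofHalfEdge (h : G.FullHalfEdge) : Arrow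
  | ofIsolated (i : G.Edge) (hi : ∀ x : Bool, G.IsTruncated (i, x)) : Arrow

/-- The vertices of the quiver of `G` are the edges of `G`. -/
def QuiverVertex : Type := G.Edge

instance : Fintype G.QuiverVertex := G.fintypeEdge

variable {G} in
/-- The start of an arrow. -/
def Arrow.source : G.Arrow → G.QuiverVertex
  | .ofHalfEdge h => h.1.1
  | .ofIsolated i _ => i

variable {G} in
/-- The end of an arrow. -/
def Arrow.target : G.Arrow → G.QuiverVertex
  | .ofHalfEdge h => (G.next h).1.1
  | .ofIsolated i _ => i

instance : Quiver.{0} G.QuiverVertex where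
  Hom i j := {α : G.Arrow // α.source = i ∧ α.target = j}

variable (K : Type v) [Field K]

variable {G} in
/-- An arrow, as an element of the path algebra of the quiver of `G`. -/
def Arrow.elt (α : G.Arrow) : PathAlgebra K G.QuiverVertex :=
  PathAlgebra.ofArrow (a := α.source) (b := α.target) ⟨α, rfl, rfl⟩

/-- The special cycle at the vertex `v` of `h` that starts with the arrow given by `h`: the list of
the `val v` half-edges at `v`, in their cyclic ordering. The special `i`-cycles are those for which
`h` belongs to the edge `i`. -/
def specialCycle (h : G.FullHalfEdge) : List G.FullHalfEdge :=
  List.iterate G.next h (G.val (G.vertexOf h.1))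

/-- The power `C_v ^ m(v)`, where `C_v` is the special cycle starting with the arrow of `h`. -/
def cyclePow (h : G.FullHalfEdge) : PathAlgebra K G.QuiverVertex :=
  ((G.specialCycle h).map fun x => (Arrow.ofHalfEdge x).elt K).prod ^ G.mult (G.vertexOf h.1)

/-- The relations that define the Brauer graph algebra. -/
inductive Relation : PathAlgebra K G.QuiverVertex → Prop
  | typeI (h h' : G.FullHalfEdge) (hh : h.1.1 = h'.1.1) :
      Relation (G.cyclePow K h - G.cyclePow K h')
  | typeII (h : G.FullHalfEdge) :
      Relation (G.cyclePow K h * (Arrow.ofHalfEdge h).elt K)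
  | typeIII (h h' : G.FullHalfEdge)
      (comp : (Arrow.ofHalfEdge h).target = (Arrow.ofHalfEdge h').source)
      (notSubpath : ∀ k : G.FullHalfEdge, ¬ [h, h'] <:+: G.specialCycle k)
      (notLoop : ¬ (h = h' ∧ G.val (G.vertexOf h.1) = 1 ∧ 1 < G.mult (G.vertexOf h.1))) :
      Relation ((Arrow.ofHalfEdge h).elt K * (Arrow.ofHalfEdge h').elt K)
  | isolated (i : G.Edge) (hi : ∀ x : Bool, G.IsTruncated (i, x)) :
      Relation ((Arrow.ofIsolated i hi).elt K * (Arrow.ofIsolated i hi).elt K)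

/-- The two-sided ideal generated by the relations. -/
def relationIdeal : Ideal (PathAlgebra K G.QuiverVertex) :=
  (TwoSidedIdeal.span {x | G.Relation K x}).asIdeal

instance : (G.relationIdeal K).IsTwoSided := by
  unfold relationIdeal
  infer_instance

/-- The (basic) Brauer graph algebra of `G`. -/
abbrev algebra : Type v := PathAlgebra K G.QuiverVertex ⧸ G.relationIdeal K

end BrauerGraph

/-- `A` is a quotient of the `K`-algebra `B`. -/
def IsQuotientAlgebra (K : Type v) [Field K] (A : Type u) [Ring A] [Algebra K A]
    (B : Type w) [Ring B] [Algebra K B] : Prop :=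
  ∃ f : B →ₐ[K] A, Function.Surjective f

end

/-! Part 1. At each vertex of `Q`, at most two arrows `γ` end and at most two arrows `β` start, and
by (S1) the relation `γ β ∉ I` is a partial matching between them. Both sets can therefore be
labelled by `Bool` so that matched arrows have equal labels. Every arrow `α` thus gets a starting
half-edge `s α` and an ending half-edge `t α` in `Q × Bool`, with `s` and `t` injective and `t α = s
β` whenever `α β ∉ I`. The partial bijection `s α ↦ t α` extends to a permutation `σ`, which is the
successor permutation of a Brauer graph `G` with edge set `Q`. All multiplicities equal some `m ≥ 2`
with `R ^ m ⊆ I`. The arrow of `G` at `s α` goes to `α`, and the arrows at the remaining half-edges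
go to `0`. The powers `C_v ^ m` have length at least `m`, so they land in `I`, and relations (I) and
(II) hold for lack of long paths. A product `α β ∉ I` comes from consecutive half-edges, which
relation (III) never kills. If `KQ/I` is indecomposable then `Q` is connected, and so is `G`,
because `s α` and `t α` lie at the same vertex of `G`.

Part 2. The map `A_G → S = KQ/I` is the identity modulo arrows, so its kernel consists of classes of
combinations of nontrivial paths and is nilpotent, since long paths vanish in `A_G`. An algebra
Morita equivalent to `S` is a corner `e M_n(S) e` with `e` a full idempotent. The kernel of
`M_n(A_G) → M_n(S)` is nil, so `e` lifts to an idempotent `e'`, which is again full, and `B = e'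
M_n(A_G) e'` is Morita equivalent to `A_G` and maps onto `e M_n(S) e`. Indecomposability passes from
the full corner to `M_n(S)` and on to `S`, which gives connectedness.

The main steps are `exists_injective_bool_of_matching`, `IsSpecialBiserialIdeal.exists_brauerGraph`,
`IsMoritaEquivalent.exists_algEquiv_corner` and `IsIdempotentElem.isMoritaEquivalent_corner`. -/

noncomputable section

/-! ### Universal property of the path algebra -/

namespace PathAlgebra

variable {K : Type v} {V : Type u} [CommRing K] [Quiver.{w} V]

/-- The product along a path of elements attached to the vertices and arrows. -/
def pathProd {B : Type*} [Mul B] (e : V → B) (x : ∀ ⦃a b : V⦄, (a ⟶ b) → B) {a : V} :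
    ∀ {b : V}, Quiver.Path a b → B
  | _, .nil => e a
  | _, .cons p α => pathProd e x p * x α

theorem ofPath_cons {a b c : V} (p : Quiver.Path a b) (α : b ⟶ c) :
    (ofPath (p.cons α) : PathAlgebra K V) = ofPath p * ofArrow α :=
  (ofPath_mul_ofPath p α.toPath).symm

theorem span_ofPath :
    Submodule.span K {x : PathAlgebra K V | ∃ (a b : V) (p : Quiver.Path a b), x = ofPath p} =
      ⊤ := by
  rw [← Submodule.ker_mkQ (Submodule.span K _), LinearMap.ker_eq_top]
  refine linearMap_ext fun a b p => ?_
  exact (Submodule.Quotient.mk_eq_zero _).2 (Submodule.subset_span ⟨a, b, p, rfl⟩)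

section Lift

variable {B : Type*} [Ring B] [Algebra K B] {e : V → B} {x : ∀ ⦃a b : V⦄, (a ⟶ b) → B}

theorem source_mul_pathProd (he : ∀ a, e a * e a = e a) {a b : V} (p : Quiver.Path a b) :
    e a * pathProd e x p = pathProd e x p := by
  induction p with
  | nil => exact he a
  | cons p α ih => rw [pathProd, ← mul_assoc, ih]

theorem pathProd_mul_target (he : ∀ a, e a * e a = e a)
    (hx : ∀ ⦃a b : V⦄ (α : a ⟶ b), x α * e b = x α) {a b : V} (p : Quiver.Path a b) :
    pathProd e x p * e b = pathProd e x p := by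
  cases p with
  | nil => exact he a
  | cons p α => rw [pathProd, mul_assoc, hx]

theorem pathProd_comp (he : ∀ a, e a * e a = e a)
    (hx : ∀ ⦃a b : V⦄ (α : a ⟶ b), x α * e b = x α) {a b c : V} (p : Quiver.Path a b)
    (q : Quiver.Path b c) : pathProd e x (p.comp q) = pathProd e x p * pathProd e x q := by
  induction q with
  | nil => exact (pathProd_mul_target he hx p).symm
  | cons q α ih => rw [Quiver.Path.comp_cons, pathProd, pathProd, ih, mul_assoc]

variable (K) in
/-- The linear extension of `pathProd`. -/
def liftLinear (e : V → B) (x : ∀ ⦃a b : V⦄, (a ⟶ b) → B) : PathAlgebra K V →ₗ[K] B :=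
  Finsupp.linearCombination K fun p : (Σ a b : V, Quiver.Path a b) => pathProd e x p.2.2

theorem liftLinear_ofPath {a b : V} (p : Quiver.Path a b) :
    liftLinear K e x (ofPath p) = pathProd e x p :=
  (Finsupp.linearCombination_single K 1 (⟨a, b, p⟩ : Σ a b : V, Quiver.Path a b)).trans
    (one_smul K _)

variable (K) in
/-- The universal property of the path algebra. -/
def lift [Fintype V] (e : V → B) (x : ∀ ⦃a b : V⦄, (a ⟶ b) → B)
    (he : CompleteOrthogonalIdempotents e)
    (ht : ∀ ⦃a b : V⦄ (α : a ⟶ b), x α * e b = x α) : PathAlgebra K V →ₐ[K] B :=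
  AlgHom.ofLinearMap (liftLinear K e x)
    (by
      rw [one_def, map_sum, ← he.complete]
      exact Finset.sum_congr rfl fun a _ => liftLinear_ofPath _)
    (by
      intro y z
      have idem : ∀ a, e a * e a = e a := fun a => he.idem a
      have h : (LinearMap.mul K (PathAlgebra K V)).compr₂ (liftLinear K e x) =
          (LinearMap.mul K B).compl₁₂ (liftLinear K e x) (liftLinear K e x) := by
        refine linearMap_ext fun a b p => linearMap_ext fun c d q => ?_
        simp only [LinearMap.compr₂_apply, LinearMap.mul_apply', LinearMap.compl₁₂_apply,
          liftLinear_ofPath]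
        by_cases hbc : b = c
        · subst hbc
          rw [ofPath_mul_ofPath, liftLinear_ofPath, pathProd_comp idem ht]
        -- Non-composable paths: orthogonal idempotents inserted between the two images make the
        -- product vanish.
        · rw [ofPath_mul_ofPath_of_ne _ _ hbc, map_zero, ← pathProd_mul_target idem ht p,
            ← source_mul_pathProd idem q, mul_assoc, ← mul_assoc (e b), he.ortho hbc, zero_mul,
            mul_zero]
      exact LinearMap.congr_fun₂ h y z)

variable [Fintype V] {he : CompleteOrthogonalIdempotents e}
  {ht : ∀ ⦃a b : V⦄ (α : a ⟶ b), x α * e b = x α}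

theorem lift_ofPath {a b : V} (p : Quiver.Path a b) :
    lift K e x he ht (ofPath p) = pathProd e x p := liftLinear_ofPath p

theorem lift_nil (a : V) : lift K e x he ht (ofPath (.nil : Quiver.Path a a)) = e a :=
  lift_ofPath _

theorem lift_ofArrow {a b : V} (α : a ⟶ b) (hs : e a * x α = x α) :
    lift K e x he ht (ofArrow α) = x α :=
  (lift_ofPath _).trans hs

end Lift

variable (K V) in
theorem completeOrthogonalIdempotents_nil [Fintype V] :
    CompleteOrthogonalIdempotents
      fun a : V => (ofPath (.nil : Quiver.Path a a) : PathAlgebra K V) where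
  idem _ := ofPath_mul_ofPath _ _
  ortho _ _ h := ofPath_mul_ofPath_of_ne _ _ h
  complete := rfl

theorem nil_mul_ofArrow [Fintype V] {a b : V} (α : a ⟶ b) :
    (ofPath (.nil : Quiver.Path a a) * ofArrow α : PathAlgebra K V) = ofArrow α := by
  rw [ofArrow, ofPath_mul_ofPath, Quiver.Path.nil_comp]

theorem ofArrow_mul_nil [Fintype V] {a b : V} (α : a ⟶ b) :
    (ofArrow α * ofPath (.nil : Quiver.Path b b) : PathAlgebra K V) = ofArrow α := by
  rw [ofArrow, ofPath_mul_ofPath, Quiver.Path.comp_nil]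

/-- A subalgebra that contains the trivial paths and the arrows is the whole path algebra. -/
theorem subalgebra_eq_top [Fintype V] {S : Subalgebra K (PathAlgebra K V)}
    (h₀ : ∀ a : V, ofPath (.nil : Quiver.Path a a) ∈ S)
    (h₁ : ∀ (a b : V) (α : a ⟶ b), ofArrow α ∈ S) : S = ⊤ := by
  rw [← Algebra.toSubmodule_eq_top, eq_top_iff, ← span_ofPath,
    Submodule.span_le]
  rintro _ ⟨a, b, p, rfl⟩
  induction p with
  | nil => exact h₀ a
  | cons p α ih =>
    rw [ofPath_cons]
    exact S.mul_mem ih (h₁ _ _ α)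

/-- An algebra map from the path algebra is determined by the trivial paths and the arrows. -/
theorem algHom_ext [Fintype V] {B : Type*} [Ring B] [Algebra K B] {f g : PathAlgebra K V →ₐ[K] B}
    (h₀ : ∀ a : V, f (ofPath (.nil : Quiver.Path a a)) = g (ofPath (.nil : Quiver.Path a a)))
    (h₁ : ∀ (a b : V) (α : a ⟶ b), f (ofArrow α) = g (ofArrow α)) : f = g :=
  AlgHom.ext fun x =>
    (subalgebra_eq_top (S := AlgHom.equalizer f g) h₀ h₁ ▸ Algebra.mem_top :
      x ∈ AlgHom.equalizer f g)

/-! ### The filtration by path length -/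

variable (K V) in
/-- The span of the paths of length at least `n`. -/
def longPaths (n : ℕ) : Submodule K (PathAlgebra K V) :=
  Submodule.span K {x | ∃ (a b : V) (p : Quiver.Path a b), n ≤ p.length ∧ x = ofPath p}

theorem ofPath_mem_longPaths {n : ℕ} {a b : V} {p : Quiver.Path a b} (h : n ≤ p.length) :
    (ofPath p : PathAlgebra K V) ∈ longPaths K V n :=
  Submodule.subset_span ⟨a, b, p, h, rfl⟩

theorem ofArrow_mem_longPaths {a b : V} (α : a ⟶ b) :
    (ofArrow α : PathAlgebra K V) ∈ longPaths K V 1 :=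
  ofPath_mem_longPaths le_rfl

theorem longPaths_antitone : Antitone (longPaths K V) := fun _ _ h =>
  Submodule.span_mono fun _ ⟨a, b, p, hp, hx⟩ => ⟨a, b, p, h.trans hp, hx⟩

theorem mul_mem_longPaths [Fintype V] {m n : ℕ} {x y : PathAlgebra K V}
    (hx : x ∈ longPaths K V m) (hy : y ∈ longPaths K V n) : x * y ∈ longPaths K V (m + n) := by
  have h : longPaths K V m * longPaths K V n ≤ longPaths K V (m + n) := by
    rw [longPaths, longPaths, Submodule.span_mul_span, Submodule.span_le]
    rintro _ ⟨_, ⟨a, b, p, hp, rfl⟩, _, ⟨c, d, q, hq, rfl⟩, rfl⟩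
    by_cases hbc : b = c
    · subst hbc
      simp only [ofPath_mul_ofPath]
      exact ofPath_mem_longPaths (by rw [Quiver.Path.length_comp]; omega)
    · simp only [ofPath_mul_ofPath_of_ne _ _ hbc]
      exact Submodule.zero_mem _
  exact h (Submodule.mul_mem_mul hx hy)

theorem longPaths_zero : longPaths K V 0 = ⊤ := by
  rw [eq_top_iff, ← span_ofPath]
  exact Submodule.span_mono fun _ ⟨a, b, p, hx⟩ => ⟨a, b, p, Nat.zero_le _, hx⟩

theorem pow_mem_longPaths [Fintype V] {x : PathAlgebra K V} (hx : x ∈ longPaths K V 1) (n : ℕ) :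
    x ^ n ∈ longPaths K V n := by
  induction n with
  | zero => exact longPaths_zero (K := K) (V := V) ▸ Submodule.mem_top
  | succ n ih => exact pow_succ x n ▸ mul_mem_longPaths ih hx

theorem listProd_mem_longPaths [Fintype V] (l : List (PathAlgebra K V))
    (hl : ∀ x ∈ l, x ∈ longPaths K V 1) : l.prod ∈ longPaths K V l.length := by
  induction l with
  | nil => exact longPaths_zero (K := K) (V := V) ▸ Submodule.mem_top
  | cons x l ih =>
    rw [List.prod_cons, List.length_cons, add_comm]
    exact mul_mem_longPaths (hl x (by simp)) (ih fun y hy => hl y (by simp [hy]))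

theorem ofPath_mem_arrowIdeal_pow [Fintype V] {a b : V} (p : Quiver.Path a b) (n : ℕ)
    (hn : n ≤ p.length) : (ofPath p : PathAlgebra K V) ∈ arrowIdeal K V ^ n := by
  have h₀ : arrowIdeal K V ^ 0 = ⊤ := by rw [Submodule.pow_zero, Ideal.one_eq_top]
  induction p generalizing n with
  | nil =>
    obtain rfl : n = 0 := by simpa using hn
    exact h₀ ▸ Submodule.mem_top
  | cons p α ih =>
    obtain _ | n := n
    · exact h₀ ▸ Submodule.mem_top
    rw [ofPath_cons, Submodule.pow_succ]
    exact Ideal.mul_mem_mul (ih n (by simpa using hn)) (TwoSidedIdeal.mem_asIdeal.2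
      (TwoSidedIdeal.subset_span ⟨_, _, α, rfl⟩))

theorem longPaths_le_arrowIdeal_pow [Fintype V] (n : ℕ) :
    longPaths K V n ≤ (arrowIdeal K V ^ n).restrictScalars K := by
  rw [longPaths, Submodule.span_le]
  rintro _ ⟨a, b, p, hp, rfl⟩
  exact ofPath_mem_arrowIdeal_pow p n hp

/-! ### The augmentation -/

variable (K V) in
open Classical in
/-- The algebra map that kills the arrows. -/
def augmentation [Fintype V] : PathAlgebra K V →ₐ[K] (V → K) :=
  lift K (fun a => Pi.single a 1) (fun _ _ _ => 0) (CompleteOrthogonalIdempotents.single _)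
    fun _ _ _ => zero_mul _

open Classical in
theorem augmentation_nil [Fintype V] (a : V) :
    augmentation K V (ofPath (.nil : Quiver.Path a a)) = Pi.single a 1 := lift_nil a

theorem augmentation_ofArrow [Fintype V] {a b : V} (α : a ⟶ b) :
    augmentation K V (ofArrow α) = 0 := lift_ofArrow α (mul_zero _)

theorem augmentation_eq_zero_of_mem_arrowIdeal [Fintype V] {x : PathAlgebra K V}
    (hx : x ∈ arrowIdeal K V) : augmentation K V x = 0 := by
  have h : TwoSidedIdeal.span {x | ∃ (a b : V) (α : a ⟶ b), x = ofArrow α} ≤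
      TwoSidedIdeal.ker (augmentation K V) := by
    rw [TwoSidedIdeal.span_le]
    rintro _ ⟨a, b, α, rfl⟩
    exact (TwoSidedIdeal.mem_ker _).2 (augmentation_ofArrow α)
  exact (TwoSidedIdeal.mem_ker _).1 (h (TwoSidedIdeal.mem_asIdeal.1 hx))

/-- Modulo nontrivial paths, an element is the combination of trivial paths whose coefficients its
augmentation records. -/
theorem mem_longPaths_one_of_augmentation_eq_zero [Fintype V] {x : PathAlgebra K V}
    (hx : augmentation K V x = 0) : x ∈ longPaths K V 1 := by
  classical
  let s : (V → K) →ₗ[K] PathAlgebra K V :=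
    Fintype.linearCombination K fun a : V => ofPath (.nil : Quiver.Path a a)
  have h : (longPaths K V 1).mkQ =
      (longPaths K V 1).mkQ ∘ₗ s ∘ₗ (augmentation K V).toLinearMap := by
    refine linearMap_ext fun a b p => ?_
    cases p with
    | nil =>
      simp [s, augmentation_nil, Fintype.linearCombination_apply_single]
    | cons p α =>
      simp only [LinearMap.comp_apply, AlgHom.toLinearMap_apply, ofPath_cons, map_mul,
        augmentation_ofArrow, mul_zero, map_zero]
      rw [← ofPath_cons]
      exact (Submodule.Quotient.mk_eq_zero _).2 (ofPath_mem_longPaths (by simp))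
  have h' := LinearMap.congr_fun h x
  rw [LinearMap.comp_apply, LinearMap.comp_apply, AlgHom.toLinearMap_apply, hx, map_zero,
    map_zero] at h'
  exact (Submodule.Quotient.mk_eq_zero _).1 h'

theorem augmentation_eq_zero_of_mem_longPaths [Fintype V] {x : PathAlgebra K V}
    (hx : x ∈ longPaths K V 1) : augmentation K V x = 0 := by
  have h := longPaths_le_arrowIdeal_pow 1 hx
  rw [Submodule.pow_one] at h
  exact augmentation_eq_zero_of_mem_arrowIdeal h

namespace IsAdmissible

variable [Fintype V] {I : Ideal (PathAlgebra K V)}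

theorem exists_longPaths_le (h : IsAdmissible I) :
    ∃ n : ℕ, 2 ≤ n ∧ ∀ x ∈ longPaths K V n, x ∈ I :=
  let ⟨n, hn, hI, _⟩ := h
  ⟨n, hn, fun _ hx => hI (longPaths_le_arrowIdeal_pow n hx)⟩

/-- Only `I ⊆ R ^ 2 ⊆ R` matters here: the trivial paths stay independent modulo `I`. -/
theorem augmentation_eq_zero (h : IsAdmissible I) {x : PathAlgebra K V} (hx : x ∈ I) :
    augmentation K V x = 0 := by
  obtain ⟨n, -, -, hI⟩ := h
  refine augmentation_eq_zero_of_mem_arrowIdeal ?_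
  have h := hI hx
  rw [Submodule.pow_succ] at h
  exact Ideal.mul_le_right h

end IsAdmissible

end PathAlgebra

/-! ### Paths in a Brauer graph algebra -/

namespace BrauerGraph

open PathAlgebra

variable (G : BrauerGraph) (K : Type v) [Field K]

theorem source_ne_target_isolated (h : G.FullHalfEdge) (i : G.Edge)
    (hi : ∀ x : Bool, G.IsTruncated (i, x)) : h.1.1 ≠ i := by
  rintro rfl
  exact h.2 (hi h.1.2)

theorem coe_next_iterate (h : G.FullHalfEdge) (k : ℕ) : (G.next^[k] h).1 = G.succ^[k] h.1 := by
  induction k with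
  | zero => rfl
  | succ k ih => rw [Function.iterate_succ_apply', Function.iterate_succ_apply', ← ih]; rfl

/-- The half-edges at a vertex form one orbit of `succ`, so the valency is the period of each of
them. -/
theorem succ_pow_val (h : G.Edge × Bool) : (G.succ ^ G.val (G.vertexOf h)) h = h := by
  classical
  have hval : G.val (G.vertexOf h) = Function.minimalPeriod (G.succ • ·) h := by
    rw [MulAction.minimalPeriod_eq_card, ← Nat.card_eq_fintype_card, val]
    refine Nat.card_congr (Equiv.subtypeEquivRight fun k => ?_)
    rw [eq_comm, ← G.sameCycle_succ_iff]
    constructor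
    · rintro ⟨n, hn⟩
      exact ⟨⟨G.succ ^ n, n, rfl⟩, hn⟩
    · rintro ⟨⟨_, n, rfl⟩, hn⟩
      exact ⟨n, hn⟩
  rw [hval, ← Equiv.Perm.iterate_eq_pow]
  exact Function.iterate_minimalPeriod

theorem val_pos (h : G.Edge × Bool) : 0 < G.val (G.vertexOf h) := by
  have : Nonempty {k : G.Edge × Bool // G.vertexOf k = G.vertexOf h} := ⟨⟨h, rfl⟩⟩
  exact Nat.card_pos

theorem next_iterate_val (h : G.FullHalfEdge) : G.next^[G.val (G.vertexOf h.1)] h = h :=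
  Subtype.ext (by rw [coe_next_iterate, Equiv.Perm.iterate_eq_pow, succ_pow_val])

theorem eq_of_val_eq_one {h h' : G.Edge × Bool} (hval : G.val (G.vertexOf h) = 1)
    (hv : G.vertexOf h' = G.vertexOf h) : h' = h := by
  have := (Nat.card_eq_one_iff_unique.1 hval).1
  exact congrArg Subtype.val (Subsingleton.elim
    (⟨h', hv⟩ : {k : G.Edge × Bool // G.vertexOf k = G.vertexOf h}) ⟨h, rfl⟩)

/-- Consecutive half-edges of a special cycle are successors of each other. -/
theorem eq_next_of_isInfix_iterate {h h' k : G.FullHalfEdge} {n : ℕ}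
    (hk : [h, h'] <:+: List.iterate G.next k n) : h' = G.next h := by
  induction n generalizing k with
  | zero => simp at hk
  | succ n ih =>
    rw [List.iterate, List.infix_cons_iff] at hk
    rcases hk with hk | hk
    · cases n with
      | zero => simp [List.iterate] at hk
      | succ n =>
        simp only [List.iterate, List.cons_prefix_cons] at hk
        rw [hk.1, hk.2.1]
    · exact ih hk

/-- The product of `n` consecutive arrows at a vertex. -/
def arcProd (h : G.FullHalfEdge) (n : ℕ) : PathAlgebra K G.QuiverVertex :=
  ((List.iterate G.next h n).map fun x => (Arrow.ofHalfEdge x).elt K).prod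

theorem arcProd_add (h : G.FullHalfEdge) (m n : ℕ) :
    G.arcProd K h (m + n) = G.arcProd K h m * G.arcProd K (G.next^[m] h) n := by
  rw [arcProd, List.iterate_add, List.map_append, List.prod_append, arcProd, arcProd]

theorem arcProd_one (h : G.FullHalfEdge) :
    G.arcProd K h 1 = (Arrow.ofHalfEdge h).elt K := by
  simp [arcProd, List.iterate]

theorem cyclePow_eq_arcProd (h : G.FullHalfEdge) : G.cyclePow K h =
    G.arcProd K h (G.mult (G.vertexOf h.1) * G.val (G.vertexOf h.1)) := by
  have H : ∀ n : ℕ, G.next^[n * G.val (G.vertexOf h.1)] h = h ∧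
      G.arcProd K h (G.val (G.vertexOf h.1)) ^ n =
        G.arcProd K h (n * G.val (G.vertexOf h.1)) := by
    intro n
    induction n with
    | zero => simp [arcProd, List.iterate]
    | succ n ih =>
      rw [Nat.succ_mul, pow_succ, ih.2, arcProd_add, ih.1, add_comm, Function.iterate_add_apply,
        ih.1, next_iterate_val]
      exact ⟨rfl, rfl⟩
  exact (H _).2

variable {G K}

theorem mem_relationIdeal {x : PathAlgebra K G.QuiverVertex} (h : G.Relation K x) :
    x ∈ G.relationIdeal K :=
  TwoSidedIdeal.mem_asIdeal.2 (TwoSidedIdeal.subset_span h)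

/-- Neighbours in a special cycle are successors, so relation (III) applies. Its exception for loops
does not interfere: at a vertex of valency one, a half-edge is its own successor. -/
theorem elt_mul_elt_mem_relationIdeal {h h' : G.FullHalfEdge}
    (comp : (G.next h).1.1 = h'.1.1) (hne : h' ≠ G.next h) :
    (Arrow.ofHalfEdge h).elt K * (Arrow.ofHalfEdge h').elt K ∈ G.relationIdeal K := by
  refine mem_relationIdeal (.typeIII h h' comp
    (fun k hk => hne (eq_next_of_isInfix_iterate G hk)) ?_)
  rintro ⟨rfl, hval, -⟩
  exact hne (Subtype.ext (G.eq_of_val_eq_one hval (G.vertexOf_succ h.1)).symm)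

/-- Such an arc begins with `C_v ^ m(v)` followed by the first arrow of `C_v`, which is relation
(II). -/
theorem arcProd_mem_relationIdeal (h : G.FullHalfEdge) {n : ℕ}
    (hn : G.mult (G.vertexOf h.1) * G.val (G.vertexOf h.1) < n) :
    G.arcProd K h n ∈ G.relationIdeal K := by
  obtain ⟨k, rfl⟩ := Nat.exists_eq_add_of_lt hn
  have hi : G.next^[G.mult (G.vertexOf h.1) * G.val (G.vertexOf h.1)] h = h := by
    rw [mul_comm, Function.iterate_mul]
    exact Function.IsFixedPt.iterate (next_iterate_val G h) _
  rw [add_assoc, arcProd_add, hi, ← cyclePow_eq_arcProd, add_comm k, arcProd_add, arcProd_one,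
    ← mul_assoc]
  exact Ideal.mul_mem_right _ _ (mem_relationIdeal (.typeII h))

/-- By relation (III), a nontrivial path can survive only by running around a single vertex of `G`
or by being the loop of an isolated edge. The proof extends the path by one arrow at a time. -/
theorem ofPath_cases {a b : G.QuiverVertex} (p : Quiver.Path a b) :
    (ofPath p ∈ G.relationIdeal K) ∨ (p.length = 0) ∨
      (∃ (i : G.Edge) (hi : ∀ x : Bool, G.IsTruncated (i, x)), b = i ∧ p.length = 1 ∧
        ofPath p = (Arrow.ofIsolated i hi).elt K) ∨
      ∃ (h : G.FullHalfEdge), p.length ≠ 0 ∧ (G.next^[p.length] h).1.1 = b ∧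
        ofPath p = G.arcProd K h p.length := by
  induction p with
  | nil => exact .inr (.inl rfl)
  | cons p α ih =>
    obtain ⟨α, rfl, rfl⟩ := α
    have hα : (ofArrow (⟨α, rfl, rfl⟩ : α.source ⟶ α.target) : PathAlgebra K G.QuiverVertex) =
      α.elt K := rfl
    rw [ofPath_cons, hα, Quiver.Path.length_cons]
    rcases ih with ih | ih | ⟨i, hi, hb, -, hp⟩ | ⟨h, hp₀, hb, hp⟩
    · exact .inl (Ideal.mul_mem_right _ _ ih)
    · obtain ⟨rfl, hp⟩ : ∃ e : _ = α.source, p = e ▸ .nil := by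
        cases p with
        | nil => exact ⟨rfl, rfl⟩
        | cons p β => simp at ih
      subst hp
      have hnil := nil_mul_ofArrow (K := K) (a := α.source) (b := α.target)
        (⟨α, rfl, rfl⟩ : α.source ⟶ α.target)
      refine .inr (.inr ?_)
      rw [hα] at hnil
      cases α with
      | ofHalfEdge h =>
        exact .inr ⟨h, by simp, by simp; rfl, by
          rw [ih, zero_add, arcProd_one]; exact hnil⟩
      | ofIsolated i hi => exact .inl ⟨i, hi, rfl, by rw [ih], hnil⟩
    -- Only the loop itself starts at a doubly truncated edge, so the longer path contains the
    -- square of the loop.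
    · refine .inl ?_
      rw [hp]
      cases α with
      | ofHalfEdge h => exact absurd hb (G.source_ne_target_isolated h i hi)
      | ofIsolated j hj =>
        obtain rfl : j = i := hb
        exact mem_relationIdeal (.isolated j hj)
    · cases α with
      | ofHalfEdge h' =>
        by_cases hne : h' = G.next^[p.length] h
        · refine .inr (.inr (.inr ⟨h, Nat.succ_ne_zero _, ?_, ?_⟩))
          · rw [Function.iterate_succ_apply', ← hne]; rfl
          · rw [hp, arcProd_add, arcProd_one]
            exact congrArg (fun k => G.arcProd K h p.length * (Arrow.ofHalfEdge k).elt K) hne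
        · refine .inl ?_
          obtain ⟨k, hk⟩ := Nat.exists_eq_add_one_of_ne_zero hp₀
          rw [hp, hk, arcProd_add, arcProd_one, mul_assoc]
          rw [hk, Function.iterate_succ_apply'] at hb hne
          exact Ideal.mul_mem_left _ _ (elt_mul_elt_mem_relationIdeal hb hne)
      | ofIsolated j hj => exact absurd hb (G.source_ne_target_isolated _ j hj)

variable (G K)

instance : Finite G.FullHalfEdge := by
  unfold FullHalfEdge
  infer_instance

theorem exists_mult_mul_val_le :
    ∃ n : ℕ, ∀ h : G.FullHalfEdge, G.mult (G.vertexOf h.1) * G.val (G.vertexOf h.1) ≤ n :=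
  Finite.exists_le _

/-- The bound `n + 2` exceeds every `m(v) val(v)` and also the length `1` of the isolated loops. -/
theorem exists_longPaths_le_relationIdeal :
    ∃ n : ℕ, ∀ x ∈ longPaths K G.QuiverVertex n, x ∈ G.relationIdeal K := by
  obtain ⟨n, hn⟩ := G.exists_mult_mul_val_le
  refine ⟨n + 2, fun x hx => ?_⟩
  have h : longPaths K G.QuiverVertex (n + 2) ≤ (G.relationIdeal K).restrictScalars K := by
    rw [longPaths, Submodule.span_le]
    rintro _ ⟨a, b, p, hp, rfl⟩
    rcases ofPath_cases (K := K) p with h | h | ⟨_, _, _, h, _⟩ | ⟨h, _, _, he⟩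
    · exact h
    · omega
    · omega
    · exact he ▸ arcProd_mem_relationIdeal h (by have := hn h; omega)
  exact h hx

/-- Trivial paths, isolated loops and arcs of bounded length span, because longer arcs vanish. -/
instance finite_algebra : Module.Finite K (G.algebra K) := by
  obtain ⟨n, hn⟩ := G.exists_mult_mul_val_le
  let π : PathAlgebra K G.QuiverVertex →ₗ[K] G.algebra K :=
    (Ideal.Quotient.mkₐ K (G.relationIdeal K)).toLinearMap
  have hπ : ∀ x ∈ G.relationIdeal K, π x = 0 := fun x hx => Ideal.Quotient.eq_zero_iff_mem.2 hx
  let s : Set (PathAlgebra K G.QuiverVertex) :=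
    Set.range (fun a : G.QuiverVertex => ofPath (.nil : Quiver.Path a a)) ∪
    Set.range (fun i : {i : G.Edge // ∀ x : Bool, G.IsTruncated (i, x)} =>
      (Arrow.ofIsolated i.1 i.2).elt K) ∪
    Set.range fun x : G.FullHalfEdge × Fin (n + 1) => G.arcProd K x.1 x.2
  have hs : s.Finite := ((Set.finite_range _).union (Set.finite_range _)).union (Set.finite_range _)
  refine ⟨Submodule.fg_def.2 ⟨π '' s, hs.image π, ?_⟩⟩
  rw [eq_top_iff, ← (LinearMap.range_eq_top (f := π)).2 Ideal.Quotient.mk_surjective,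
    ← Submodule.map_top, ← span_ofPath, Submodule.map_span_le]
  rintro _ ⟨a, b, p, rfl⟩
  have hmem : ∀ x ∈ s, π x ∈ Submodule.span K (π '' s) := fun x hx =>
    Submodule.subset_span ⟨x, hx, rfl⟩
  rcases ofPath_cases (K := K) p with h | h | ⟨i, hi, _, _, he⟩ | ⟨h, _, _, he⟩
  · rw [hπ _ h]
    exact Submodule.zero_mem _
  · cases p with
    | nil => exact hmem _ (.inl (.inl ⟨a, rfl⟩))
    | cons p α => simp at h
  · exact he ▸ hmem _ (.inl (.inr ⟨⟨i, hi⟩, rfl⟩))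
  · rw [he]
    by_cases hp : p.length < n + 1
    · exact hmem _ (.inr ⟨(h, ⟨p.length, hp⟩), rfl⟩)
    · rw [hπ _ (arcProd_mem_relationIdeal h (by have := hn h; omega))]
      exact Submodule.zero_mem _

end BrauerGraph

/-! ### Labelling arrows by half-edges -/

/-- Two injections into a finite type differ by a permutation. -/
theorem exists_perm_apply_eq {X Y : Type*} [Finite Y] {f g : X → Y} (hf : f.Injective)
    (hg : g.Injective) : ∃ π : Equiv.Perm Y, ∀ x, π (f x) = g x := by
  classical
  have := Fintype.ofFinite Y
  let φ : {y // y ∈ Set.range f} ≃ {y // y ∈ Set.range g} :=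
    (Equiv.ofInjective f hf).symm.trans (Equiv.ofInjective g hg)
  refine ⟨φ.extendSubtype, fun x => ?_⟩
  rw [φ.extendSubtype_apply_of_mem (f x) ⟨x, rfl⟩]
  have h : (⟨f x, ⟨x, rfl⟩⟩ : {y // y ∈ Set.range f}) = Equiv.ofInjective f hf x := rfl
  rw [h]
  simp [φ]

theorem exists_injective_bool {X : Type*} (h : ENat.card X ≤ 2) : ∃ f : X → Bool, f.Injective := by
  have : Finite X := by
    rw [← ENat.card_lt_top]
    exact h.trans_lt (by decide)
  have := Fintype.ofFinite X
  rw [ENat.card_eq_coe_fintype_card] at h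
  obtain ⟨f⟩ := Function.Embedding.nonempty_of_card_le (α := X) (β := Bool)
    (by simpa using (by exact_mod_cast h : Fintype.card X ≤ 2))
  exact ⟨f, f.injective⟩

/-- A partial matching between two types with at most two elements is induced by injections
into `Bool`. -/
theorem exists_injective_bool_of_matching {X Y : Type*} (hX : ENat.card X ≤ 2)
    (hY : ENat.card Y ≤ 2) (r : X → Y → Prop) (h₁ : ∀ x y y', r x y → r x y' → y = y')
    (h₂ : ∀ x x' y, r x y → r x' y → x = x') :
    ∃ (f : X → Bool) (g : Y → Bool), f.Injective ∧ g.Injective ∧ ∀ x y, r x y → f x = g y := by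
  obtain ⟨f, hf⟩ := exists_injective_bool hX
  obtain ⟨g, hg⟩ := exists_injective_bool hY
  -- Start from arbitrary labels `f` and `g`. On the matched pairs both are injective, so a
  -- permutation `π` of `Bool` corrects `g` to agree with `f` there.
  obtain ⟨π, hπ⟩ := exists_perm_apply_eq (X := {p : X × Y // r p.1 p.2})
    (f := fun p => g p.1.2) (g := fun p => f p.1.1)
    (fun p q h => Subtype.ext (Prod.ext (h₂ _ _ _ p.2 (hg h ▸ q.2)) (hg h)))
    (fun p q h => Subtype.ext (Prod.ext (hf h) (h₁ _ _ _ p.2 (hf h ▸ q.2))))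
  exact ⟨f, π ∘ g, hf, π.injective.comp hg, fun x y hr => (hπ ⟨(x, y), hr⟩).symm⟩

/-! ### Brauer graphs from permutations, and connectedness -/

namespace BrauerGraph

/-- The Brauer graph with edges `E`, all multiplicities `m`, and successor permutation `σ`. -/
def ofPerm {E : Type} [Fintype E] (σ : Equiv.Perm (E × Bool)) (m : ℕ) (hm : 0 < m) :
    BrauerGraph where
  Vertex := Quotient (Equiv.Perm.SameCycle.setoid σ)
  Edge := E
  fintypeVertex := Fintype.ofFinite _
  vertexOf := Quotient.mk _
  mult _ := m
  mult_pos _ := hm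
  succ := σ
  sameCycle_succ_iff _ _ := (Quotient.eq (r := Equiv.Perm.SameCycle.setoid σ)).symm

/-- A graph without isolated vertices is connected if its edges cannot be separated. -/
theorem isConnected_of_edges (G : BrauerGraph) [Nonempty G.Edge]
    (hsurj : Function.Surjective G.vertexOf)
    (h : ∀ S : Set G.Edge, S.Nonempty →
      (∀ x y : G.Edge × Bool, G.vertexOf x = G.vertexOf y → x.1 ∈ S → y.1 ∈ S) → S = Set.univ) :
    G.IsConnected := by
  have hadj : ∀ i x y, (SimpleGraph.fromRel fun v w : G.Vertex =>
      ∃ i : G.Edge, G.vertexOf (i, false) = v ∧ G.vertexOf (i, true) = w).Reachable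
        (G.vertexOf (i, x)) (G.vertexOf (i, y)) := by
    have h₀ : ∀ i, (SimpleGraph.fromRel fun v w : G.Vertex =>
      ∃ i : G.Edge, G.vertexOf (i, false) = v ∧ G.vertexOf (i, true) = w).Reachable
        (G.vertexOf (i, false)) (G.vertexOf (i, true)) := by
      intro i
      by_cases hi : G.vertexOf (i, false) = G.vertexOf (i, true)
      · rw [hi]
      · exact SimpleGraph.Adj.reachable ((SimpleGraph.fromRel_adj _ _ _).2
          ⟨hi, .inl ⟨i, rfl, rfl⟩⟩)
    rintro i (_ | _) (_ | _)
    exacts [.rfl, h₀ i, (h₀ i).symm, .rfl]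
  obtain ⟨i₀⟩ := ‹Nonempty G.Edge›
  have : Nonempty G.Vertex := ⟨G.vertexOf (i₀, false)⟩
  -- The edges reachable from a base edge are closed under sharing a vertex, since the two ends of
  -- an edge are always reachable from each other.
  have key := h {i | (SimpleGraph.fromRel fun v w : G.Vertex =>
      ∃ i : G.Edge, G.vertexOf (i, false) = v ∧ G.vertexOf (i, true) = w).Reachable
        (G.vertexOf (i₀, false)) (G.vertexOf (i, false))} ⟨i₀, .rfl⟩ (by
    rintro ⟨i, x⟩ ⟨j, y⟩ hxy hi
    exact (hi.trans (hadj i false x)).trans (hxy ▸ hadj j y false))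
  refine SimpleGraph.connected_iff_exists_forall_reachable _ |>.2 ⟨G.vertexOf (i₀, false), ?_⟩
  intro v
  obtain ⟨⟨i, x⟩, rfl⟩ := hsurj v
  exact SimpleGraph.Reachable.trans (show i ∈ _ from key ▸ Set.mem_univ i) (hadj i false x)

end BrauerGraph

/-! ### Indecomposability and connected quivers -/

namespace PathAlgebra

variable {K : Type v} [Field K] {Q : Type u} [Fintype Q] [Quiver.{w} Q]

/-- The vertex idempotents of a union of connected components of the quiver add up to a central
element. -/
theorem exists_eq_of_isIndecomposableRing {I : Ideal (PathAlgebra K Q)} [I.IsTwoSided]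
    (hI : IsAdmissible I) (hA : IsIndecomposableRing (PathAlgebra K Q ⧸ I)) (S : Set Q)
    (hne : S.Nonempty) (hS : ∀ a b : Q, ∀ _ : a ⟶ b, a ∈ S ↔ b ∈ S) : S = Set.univ := by
  classical
  let χ : Q → PathAlgebra K Q := fun a =>
    if a ∈ S then ofPath (.nil : Quiver.Path a a) else 0
  let ε : PathAlgebra K Q := ∑ a, χ a
  have hpath : ∀ (a b : Q) (p : Quiver.Path a b), a ∈ S ↔ b ∈ S := by
    intro a b p
    induction p with
    | nil => rfl
    | cons p α ih => exact ih.trans (hS _ _ α)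
  have hl : ∀ (a b : Q) (p : Quiver.Path a b),
      ε * ofPath p = if a ∈ S then ofPath p else 0 := by
    intro a b p
    rw [Finset.sum_mul, Finset.sum_eq_single a]
    · simp only [χ, ite_mul, zero_mul, ofPath_mul_ofPath, Quiver.Path.nil_comp]
    · intro c _ hc
      simp only [χ, ite_mul, zero_mul, ofPath_mul_ofPath_of_ne _ p hc, ite_self]
    · exact fun h => absurd (Finset.mem_univ a) h
  have hr : ∀ (a b : Q) (p : Quiver.Path a b),
      ofPath p * ε = if b ∈ S then ofPath p else 0 := by
    intro a b p
    rw [Finset.mul_sum, Finset.sum_eq_single b]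
    · simp only [χ, mul_ite, mul_zero, ofPath_mul_ofPath, Quiver.Path.comp_nil]
    · intro c _ hc
      simp only [χ, mul_ite, mul_zero, ofPath_mul_ofPath_of_ne p _ (Ne.symm hc), ite_self]
    · exact fun h => absurd (Finset.mem_univ b) h
  have hcomm : ∀ x : PathAlgebra K Q, ε * x = x * ε := by
    have h : LinearMap.mulLeft K ε = LinearMap.mulRight K ε := linearMap_ext fun a b p => by
      simp only [LinearMap.mulLeft_apply, LinearMap.mulRight_apply, hl, hr, hpath a b p]
    exact LinearMap.congr_fun h
  have hidem : ε * ε = ε := by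
    have h : ∀ a, χ a * ε = χ a := fun a => by
      by_cases ha : a ∈ S
      · simp only [χ, if_pos ha, hr]
      · simp only [χ, if_neg ha, zero_mul]
    have h' : (∑ a, χ a) * ε = ∑ a, χ a := by
      rw [Finset.sum_mul]
      exact Finset.sum_congr rfl fun a _ => h a
    exact h'
  -- The augmentation vanishes on `I` and sends `ε` to the indicator function of `S`. Hence `ε ∈ I`
  -- forces `S` to be empty, and `ε - 1 ∈ I` forces `S` to be everything.
  have haug : ∀ a : Q, augmentation K Q ε a = if a ∈ S then 1 else 0 := by
    intro a
    rw [map_sum, Finset.sum_apply, Finset.sum_eq_single a]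
    · by_cases ha : a ∈ S <;> simp [χ, ha, augmentation_nil]
    · intro c _ hc
      by_cases hcS : c ∈ S <;> simp [χ, hcS, augmentation_nil, hc.symm]
    · exact fun h => absurd (Finset.mem_univ a) h
  have hε := hA.2 (Ideal.Quotient.mk I ε)
    (Subring.mem_center_iff.2 fun x => by
      obtain ⟨x, rfl⟩ := Ideal.Quotient.mk_surjective x
      rw [← map_mul, ← map_mul, hcomm])
    (by rw [IsIdempotentElem, ← map_mul, hidem])
  rcases hε with hε | hε
  · obtain ⟨a, ha⟩ := hne
    have := congrFun (hI.augmentation_eq_zero (Ideal.Quotient.eq_zero_iff_mem.1 hε)) a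
    simp [haug, ha] at this
  · rw [← map_one (Ideal.Quotient.mk I), Ideal.Quotient.eq] at hε
    refine Set.eq_univ_of_forall fun a => ?_
    have := congrFun (hI.augmentation_eq_zero hε) a
    by_contra ha
    simp [haug, ha] at this

theorem nonempty_of_nontrivial {I : Ideal (PathAlgebra K Q)} [I.IsTwoSided]
    [Nontrivial (PathAlgebra K Q ⧸ I)] : Nonempty Q := by
  by_contra h
  rw [not_nonempty_iff] at h
  have h₁ : (1 : PathAlgebra K Q) = 0 := by rw [one_def]; simp
  exact one_ne_zero (α := PathAlgebra K Q ⧸ I)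
    (by rw [← map_one (Ideal.Quotient.mk I), h₁, map_zero])

end PathAlgebra

/-! ### The Brauer graph of a special biserial bound quiver algebra -/

namespace PathAlgebra

variable {K : Type v} [Field K] {Q : Type} [Fintype Q] [Quiver.{0} Q]

/-- The half-edges at which the arrows start and end, for a Brauer graph whose algebra maps onto
`K Q / I`. -/
theorem IsSpecialBiserialIdeal.exists_halfEdges {I : Ideal (PathAlgebra K Q)}
    (hI : IsSpecialBiserialIdeal I) :
    ∃ s t : (Σ a b : Q, a ⟶ b) → Q × Bool, s.Injective ∧ t.Injective ∧
      (∀ α, (s α).1 = α.1) ∧ (∀ α, (t α).1 = α.2.1) ∧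
      ∀ (a b c : Q) (α : a ⟶ b) (β : b ⟶ c), (ofArrow α * ofArrow β : PathAlgebra K Q) ∉ I →
        t ⟨a, b, α⟩ = s ⟨b, c, β⟩ := by
  -- At the vertex `i`, the incoming arrows are matched with the outgoing ones by nonzero
  -- composition. (S0) bounds both sets and (S1) says that this is a matching.
  choose f g hf hg hfg using fun i : Q => exists_injective_bool_of_matching
    (X := Σ b : Q, b ⟶ i) (Y := Σ b : Q, i ⟶ b) (hI.conditionS0 i).2 (hI.conditionS0 i).1
    (fun γ β => (ofArrow γ.2 * ofArrow β.2 : PathAlgebra K Q) ∉ I)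
    (fun γ β β' h h' => (hI.conditionS1 _ _ γ.2).1 h h')
    (fun γ γ' β h h' => (hI.conditionS1 _ _ β.2).2 h h')
  refine ⟨fun α => (α.1, g α.1 ⟨α.2.1, α.2.2⟩), fun α => (α.2.1, f α.2.1 ⟨α.1, α.2.2⟩), ?_, ?_,
    fun _ => rfl, fun _ => rfl, fun a b c α β h => Prod.ext rfl (hfg b ⟨a, α⟩ ⟨c, β⟩ h)⟩
  · rintro ⟨a, b, α⟩ ⟨a', b', α'⟩ h
    obtain ⟨h₁, h₂⟩ := Prod.ext_iff.1 h
    obtain rfl : a = a' := h₁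
    cases hg a h₂
    rfl
  · rintro ⟨a, b, α⟩ ⟨a', b', α'⟩ h
    obtain ⟨h₁, h₂⟩ := Prod.ext_iff.1 h
    obtain rfl : b = b' := h₁
    cases hf b h₂
    rfl

/-- A special biserial bound quiver algebra is the quotient of a Brauer graph algebra by a nil
ideal. -/
theorem IsSpecialBiserialIdeal.exists_brauerGraph {I : Ideal (PathAlgebra K Q)} [I.IsTwoSided]
    (hI : IsSpecialBiserialIdeal I) :
    ∃ G : BrauerGraph, (IsIndecomposableRing (PathAlgebra K Q ⧸ I) → G.IsConnected) ∧
      ∃ f : G.algebra K →ₐ[K] PathAlgebra K Q ⧸ I, Function.Surjective f ∧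
        ∃ n : ℕ, RingHom.ker f ^ n = ⊥ := by
  obtain ⟨s, t, hs, ht, hs₁, ht₁, hst⟩ := hI.exists_halfEdges
  -- The successor of the half-edge where an arrow starts is the half-edge where it ends.
  obtain ⟨σ, hσ⟩ := exists_perm_apply_eq hs ht
  obtain ⟨m, hm, hmI⟩ := hI.isAdmissible.exists_longPaths_le
  let G : BrauerGraph := .ofPerm σ m (by omega)
  -- As `m ≥ 2`, no edge is truncated, so every half-edge carries an arrow and isolated loops do not
  -- occur.
  have hG : ∀ h : G.Edge × Bool, ¬ G.IsTruncated h := fun h hh => by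
    have : m = 1 := Nat.eq_one_of_mul_eq_one_right hh
    omega
  -- Half-edges at which no arrow of `Q` starts are sent to `0`.
  let y : Q × Bool → PathAlgebra K Q := Function.extend s (fun α => ofArrow α.2.2) 0
  have hy : ∀ h, y h = 0 ∨ ∃ α, s α = h ∧ y h = ofArrow α.2.2 := by
    intro h
    by_cases hh : ∃ α, s α = h
    · obtain ⟨α, rfl⟩ := hh
      exact .inr ⟨α, rfl, hs.extend_apply _ _ _⟩
    · exact .inl (Function.extend_apply' _ _ _ hh)
  let x : G.Arrow → PathAlgebra K Q
    | .ofHalfEdge h => y h.1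
    | .ofIsolated _ _ => 0
  have hxs : ∀ α : G.Arrow, ofPath (.nil : Quiver.Path (V := Q) α.source α.source) * x α = x α := by
    rintro (h | ⟨i, hi⟩)
    · rcases hy h.1 with h0 | ⟨α, hα, hx⟩
      · show _ * y h.1 = y h.1
        rw [h0, mul_zero]
      · have : (BrauerGraph.Arrow.ofHalfEdge h).source = α.1 :=
          (congrArg Prod.fst hα).symm.trans (hs₁ α)
        show _ * y h.1 = y h.1
        rw [hx, this]
        exact nil_mul_ofArrow _
    · exact mul_zero _
  have hxt : ∀ α : G.Arrow, x α * ofPath (.nil : Quiver.Path (V := Q) α.target α.target) = x α := by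
    rintro (h | ⟨i, hi⟩)
    · rcases hy h.1 with h0 | ⟨α, hα, hx⟩
      · show y h.1 * _ = y h.1
        rw [h0, zero_mul]
      · have : (BrauerGraph.Arrow.ofHalfEdge h).target = α.2.1 :=
          (congrArg Prod.fst ((congrArg σ hα).symm.trans (hσ α))).trans (ht₁ α)
        show y h.1 * _ = y h.1
        rw [hx, this]
        exact ofArrow_mul_nil _
    · exact zero_mul _
  let φ : PathAlgebra K G.QuiverVertex →ₐ[K] PathAlgebra K Q :=
    lift K (fun a : Q => ofPath (.nil : Quiver.Path a a)) (fun _ _ α => x α.1)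
      (completeOrthogonalIdempotents_nil K Q) (by rintro _ _ ⟨α, rfl, rfl⟩; exact hxt α)
  have hφ : ∀ α : G.Arrow, φ (α.elt K) = x α := fun α => lift_ofArrow _ (hxs α)
  have hφ₀ : ∀ a : Q, φ (ofPath (.nil : Quiver.Path (V := G.QuiverVertex) a a)) =
    ofPath (.nil : Quiver.Path a a) := fun a => lift_nil (V := G.QuiverVertex) a
  have hφ₁ : ∀ α : (Σ a b : Q, a ⟶ b), φ ((BrauerGraph.Arrow.ofHalfEdge ⟨s α, hG _⟩).elt K) =
      ofArrow α.2.2 := fun α => (hφ _).trans (hs.extend_apply _ _ _)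
  have hx₁ : ∀ α : G.Arrow, x α ∈ longPaths K Q 1 := by
    rintro (h | ⟨i, hi⟩)
    · rcases hy h.1 with h0 | ⟨α, -, hx⟩
      · show y h.1 ∈ _
        exact h0 ▸ Submodule.zero_mem (longPaths K Q 1)
      · show y h.1 ∈ _
        exact hx ▸ ofArrow_mem_longPaths α.2.2
    · exact Submodule.zero_mem (longPaths K Q 1)
  -- A special cycle has at least one arrow, so its `m`-th power has length at least `m`. In
  -- relation (I), each of the two terms thus lands in `I` by itself.
  have hlong : ∀ h : G.FullHalfEdge, φ (G.cyclePow K h) ∈ longPaths K Q m := by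
    intro h
    rw [BrauerGraph.cyclePow, map_pow, map_list_prod]
    refine pow_mem_longPaths (longPaths_antitone ?_ (listProd_mem_longPaths _ ?_)) m
    · rw [List.length_map, List.length_map, BrauerGraph.specialCycle, List.length_iterate]
      exact G.val_pos h.1
    · simp only [List.mem_map, forall_exists_index, and_imp, forall_apply_eq_imp_iff₂]
      exact fun k _ => (congrArg (· ∈ longPaths K Q 1) (hφ (.ofHalfEdge k))).mpr
        (hx₁ (.ofHalfEdge k))
  have hnext : ∀ (k : ℕ) (h : G.FullHalfEdge),
      [h, G.next h] <:+: List.iterate G.next h (k + 2) := fun k h =>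
    List.IsPrefix.isInfix ⟨List.iterate G.next (G.next (G.next h)) k, rfl⟩
  have hrel : ∀ z ∈ G.relationIdeal K, φ z ∈ I := by
    intro z hz
    have h : TwoSidedIdeal.span {z | G.Relation K z} ≤
        TwoSidedIdeal.ker ((Ideal.Quotient.mkₐ K I).comp φ) := by
      rw [TwoSidedIdeal.span_le]
      intro z hz
      refine (TwoSidedIdeal.mem_ker _).2 (Ideal.Quotient.eq_zero_iff_mem.2 ?_)
      cases hz with
      | typeI h h' _ =>
        rw [map_sub]
        exact I.sub_mem (hmI _ (hlong h)) (hmI _ (hlong h'))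
      | typeII h =>
        rw [map_mul]
        exact I.mul_mem_right _ (hmI _ (hlong h))
      | typeIII h h' comp notSubpath notLoop =>
        rw [map_mul]
        show φ _ * φ _ ∈ I
        rw [hφ, hφ]
        show y h.1 * y h'.1 ∈ I
        rcases hy h.1 with h0 | ⟨⟨a, b, α⟩, hα, hx⟩
        · rw [h0, zero_mul]; exact I.zero_mem
        rcases hy h'.1 with h0 | ⟨⟨c, d, β⟩, hβ, hx'⟩
        · rw [h0, mul_zero]; exact I.zero_mem
        rw [hx, hx']
        have hn : (G.next h).1 = t ⟨a, b, α⟩ := (congrArg σ hα).symm.trans (hσ _)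
        have hbc : b = c := by
          have h₁ : (G.next h).1.1 = b := (congrArg Prod.fst hn).trans (ht₁ _)
          have h₂ : h'.1.1 = c := (congrArg Prod.fst hβ).symm.trans (hs₁ _)
          exact h₁.symm.trans (comp.trans h₂)
        subst hbc
        -- If `α β ∉ I`, the labels agree and `h'` is the successor of `h`. Then relation (III) does
        -- not apply: `[h, h']` is part of a special cycle when the valency is at least two, and the
        -- exception for loops covers valency one because `m > 1`.
        by_contra hαβ
        have hh : h' = G.next h :=
          Subtype.ext (hβ.symm.trans ((hst _ _ _ α β hαβ).symm.trans hn.symm))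
        subst hh
        have hpos := G.val_pos h.1
        by_cases h1 : G.val (G.vertexOf h.1) = 1
        · exact notLoop ⟨(Subtype.ext (G.eq_of_val_eq_one h1 (G.vertexOf_succ h.1))).symm, h1, hm⟩
        · obtain ⟨k, hk⟩ : ∃ k, G.val (G.vertexOf h.1) = k + 2 :=
            ⟨G.val (G.vertexOf h.1) - 2, by omega⟩
          exact notSubpath h (by rw [BrauerGraph.specialCycle, hk]; exact hnext k h)
      | isolated i hi => exact absurd (hi true) (hG _)
    exact Ideal.Quotient.eq_zero_iff_mem.1
      ((TwoSidedIdeal.mem_ker _).1 (h (TwoSidedIdeal.mem_asIdeal.1 hz)))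
  have hφsurj : Function.Surjective φ := by
    rw [← AlgHom.range_eq_top]
    exact subalgebra_eq_top (fun a => ⟨_, hφ₀ a⟩) fun a b α => ⟨_, hφ₁ ⟨a, b, α⟩⟩
  -- The vertices of the quiver of `G` are those of `Q`; `ψ` only changes the name of the type. With
  -- it, `φ` commutes with the augmentations.
  let ψ : (Q → K) →ₐ[K] (G.QuiverVertex → K) := AlgHom.id K (Q → K)
  have haug : (ψ.comp (augmentation K Q)).comp φ = augmentation K G.QuiverVertex := by
    refine algHom_ext (fun a => ?_) fun a b α => ?_
    · rw [augmentation_nil]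
      exact (congrArg (augmentation K Q) (hφ₀ a)).trans (augmentation_nil (V := Q) a)
    · obtain ⟨α, rfl, rfl⟩ := α
      rw [augmentation_ofArrow]
      exact (congrArg (augmentation K Q) (hφ α)).trans
        (augmentation_eq_zero_of_mem_longPaths (hx₁ α))
  refine ⟨G, fun hA => ?_, Ideal.Quotient.liftₐ _ ((Ideal.Quotient.mkₐ K I).comp φ)
    fun z hz => Ideal.Quotient.eq_zero_iff_mem.2 (hrel z hz), ?_, ?_⟩
  · have := hA.1
    have : Nonempty G.Edge := nonempty_of_nontrivial (Q := Q) (I := I)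
    refine G.isConnected_of_edges Quotient.mk_surjective fun S hne hS =>
      exists_eq_of_isIndecomposableRing (Q := Q) hI.isAdmissible hA S hne
        fun (a b : Q) (α : a ⟶ b) => ?_
    -- An arrow of `Q` joins two edges of `G` that meet at the common vertex of `s γ` and `t γ`.
    let γ : Σ a b : Q, a ⟶ b := ⟨a, b, α⟩
    have h : G.vertexOf (s γ) = G.vertexOf (t γ) := hσ γ ▸ (G.vertexOf_succ (s γ)).symm
    have h₁ := hS _ _ h
    have h₂ := hS _ _ h.symm
    rw [hs₁, ht₁] at h₁ h₂
    exact ⟨h₁, h₂⟩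
  · intro z
    obtain ⟨z, rfl⟩ := Ideal.Quotient.mk_surjective z
    obtain ⟨z, rfl⟩ := hφsurj z
    exact ⟨Ideal.Quotient.mk _ z, rfl⟩
  · obtain ⟨n, hn⟩ := G.exists_longPaths_le_relationIdeal K
    refine ⟨n, ?_⟩
    -- A kernel element has a representative of augmentation zero, hence made of nontrivial paths.
    -- Its products of `k` factors consist of paths of length at least `k`, and these vanish for `k
    -- = n`.
    have h : ∀ k, ∀ z ∈ RingHom.ker (Ideal.Quotient.liftₐ (G.relationIdeal K)
        ((Ideal.Quotient.mkₐ K I).comp φ)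
        fun z hz => Ideal.Quotient.eq_zero_iff_mem.2 (hrel z hz)) ^ k,
        ∃ w ∈ longPaths K G.QuiverVertex k, Ideal.Quotient.mk _ w = z := by
      intro k
      induction k with
      | zero =>
        intro z _
        obtain ⟨w, rfl⟩ := Ideal.Quotient.mk_surjective z
        exact ⟨w, by rw [longPaths_zero]; trivial, rfl⟩
      | succ k ih =>
        intro z hz
        rw [Submodule.pow_succ] at hz
        induction hz using Submodule.mul_induction_on' with
        | mem_mul_mem z hz z' hz' =>
          obtain ⟨w, hw, rfl⟩ := ih z hz
          obtain ⟨w', rfl⟩ := Ideal.Quotient.mk_surjective z'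
          refine ⟨w * w', mul_mem_longPaths hw (mem_longPaths_one_of_augmentation_eq_zero ?_),
            map_mul _ _ _⟩
          rw [← haug]
          exact hI.isAdmissible.augmentation_eq_zero (Ideal.Quotient.eq_zero_iff_mem.1 hz')
        | add z _ z' _ hz hz' =>
          obtain ⟨w, hw, rfl⟩ := hz
          obtain ⟨w', hw', rfl⟩ := hz'
          exact ⟨w + w', Submodule.add_mem _ hw hw', map_add _ _ _⟩
    rw [eq_bot_iff]
    intro z hz
    obtain ⟨w, hw, rfl⟩ := h n z hz
    exact Ideal.Quotient.eq_zero_iff_mem.2 (hn w hw)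

end PathAlgebra

/-! ### Corner rings -/

/-- An element generates the unit ideal. -/
def IsFullElement {R : Type*} [Ring R] (e : R) : Prop :=
  ∃ (ι : Type) (_ : Fintype ι) (a b : ι → R), ∑ i, a i * e * b i = 1

namespace IsIdempotentElem

variable {K : Type*} [CommRing K] {R : Type*} [Ring R] [Algebra K R] {e : R}
  (he : IsIdempotentElem e)

namespace Corner

/-- The element `e * x * e` of the corner. -/
def mk (x : R) : he.Corner := ⟨e * x * e, x, rfl⟩

variable {he}

theorem ext {x y : he.Corner} (h : x.1 = y.1) : x = y := Subtype.ext h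

theorem coe_mk (x : R) : (mk he x).1 = e * x * e := rfl
theorem coe_one : (1 : he.Corner).1 = e := rfl
theorem coe_mul (x y : he.Corner) : (x * y).1 = x.1 * y.1 := rfl
theorem coe_add (x y : he.Corner) : (x + y).1 = x.1 + y.1 := rfl
theorem coe_zero : (0 : he.Corner).1 = 0 := rfl

theorem mul_coe (x : he.Corner) : e * x.1 = x.1 := ((Subsemigroup.mem_corner_iff he).1 x.2).1
theorem coe_mul_idem (x : he.Corner) : x.1 * e = x.1 := ((Subsemigroup.mem_corner_iff he).1 x.2).2

end Corner

instance : SMul K he.Corner where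
  smul k x := ⟨k • x.1, k • x.1, by
    simp only [mul_smul_comm, smul_mul_assoc, Corner.mul_coe, Corner.coe_mul_idem]⟩

instance : Module K he.Corner :=
  Function.Injective.module K
    ({ toFun := fun x => x.1, map_zero' := rfl, map_add' := fun _ _ => rfl } : he.Corner →+ R)
    (fun _ _ h => Corner.ext h) (fun _ _ => rfl)

instance : Algebra K he.Corner :=
  Algebra.ofModule (fun k x y => Corner.ext (smul_mul_assoc k x.1 y.1))
    (fun k x y => Corner.ext (mul_smul_comm k x.1 y.1))

theorem Corner.coe_algebraMap (k : K) : (algebraMap K he.Corner k).1 = k • e := by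
  rw [Algebra.algebraMap_eq_smul_one]
  rfl

variable (K) in
/-- The inclusion of the corner, as a linear map. -/
def Corner.subtype : he.Corner →ₗ[K] R where
  toFun x := x.1
  map_add' _ _ := rfl
  map_smul' _ _ := rfl

theorem finite_corner {K : Type*} [Field K] [Algebra K R] [Module.Finite K R] :
    Module.Finite K he.Corner :=
  Module.Finite.of_injective (Corner.subtype K he) fun _ _ h => Corner.ext h

/-- A homomorphism restricts to the corners. -/
def mapCorner {S : Type*} [Ring S] [Algebra K S] (f : R →ₐ[K] S) {e' : S}
    (he' : IsIdempotentElem e') (h : f e = e') : he.Corner →ₐ[K] he'.Corner :=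
  AlgHom.ofLinearMap
    { toFun := fun x => ⟨f x.1, f x.1, by
        simp only [← h, ← map_mul, Corner.mul_coe, Corner.coe_mul_idem]⟩
      map_add' := fun x y => Corner.ext (map_add f x.1 y.1)
      map_smul' := fun k x => Corner.ext (map_smul f k x.1) }
    (Corner.ext h) fun x y => Corner.ext (map_mul f x.1 y.1)

theorem mapCorner_surjective {S : Type*} [Ring S] [Algebra K S] (f : R →ₐ[K] S) {e' : S}
    (he' : IsIdempotentElem e') (h : f e = e') (hf : Function.Surjective f) :
    Function.Surjective (mapCorner he f he' h) := by
  intro y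
  obtain ⟨x, hx⟩ := hf y.1
  refine ⟨Corner.mk he x, Corner.ext ?_⟩
  show f (e * x * e) = y.1
  rw [map_mul, map_mul, h, hx, Corner.mul_coe, Corner.coe_mul_idem]

/-! ### The corner functor -/

section Functor

variable (M : Type*) [AddCommGroup M] [Module R M]

variable (e) in
/-- The elements fixed by an idempotent. -/
def fixed : AddSubgroup M where
  carrier := {m | e • m = m}
  add_mem' {x y} hx hy := by
    show e • (x + y) = x + y
    rw [smul_add, show e • x = x from hx, show e • y = y from hy]
  zero_mem' := smul_zero e
  neg_mem' {x} hx := by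
    show e • (-x) = -x
    rw [smul_neg, show e • x = x from hx]

variable {M}

theorem smul_mem_fixed (he : IsIdempotentElem e) (m : M) : e • m ∈ fixed e M := by
  show e • e • m = e • m
  rw [smul_smul, he.eq]

instance : SMul he.Corner (fixed e M) where
  smul c m := ⟨c.1 • m.1, by
    show e • c.1 • m.1 = c.1 • m.1
    rw [smul_smul, Corner.mul_coe]⟩

theorem coe_corner_smul (c : he.Corner) (m : fixed e M) : (c • m).1 = c.1 • m.1 := rfl

instance : Module he.Corner (fixed e M) where
  one_smul m := Subtype.ext m.2
  mul_smul c d m := Subtype.ext (mul_smul c.1 d.1 m.1)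
  smul_zero c := Subtype.ext (smul_zero c.1)
  smul_add c m n := Subtype.ext (smul_add c.1 m.1 n.1)
  add_smul c d m := Subtype.ext (add_smul c.1 d.1 m.1)
  zero_smul m := Subtype.ext (zero_smul R m.1)

/-- The restriction of a linear map to the elements fixed by an idempotent. -/
def mapFixed {N : Type*} [AddCommGroup N] [Module R N] (f : M →ₗ[R] N) :
    fixed e M →ₗ[he.Corner] fixed e N where
  toFun m := ⟨f m.1, by
    show e • f m.1 = f m.1
    rw [← map_smul, show e • m.1 = m.1 from m.2]⟩
  map_add' m n := Subtype.ext (map_add f m.1 n.1)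
  map_smul' c m := Subtype.ext (map_smul f c.1 m.1)

open CategoryTheory

/-- The functor `M ↦ e M` from modules over `R` to modules over the corner of `e`. -/
def cornerFunctor : ModuleCat.{w} R ⥤ ModuleCat.{w} he.Corner where
  obj M := ModuleCat.of he.Corner (fixed e M)
  map f := ModuleCat.ofHom (mapFixed he f.hom)
  map_id _ := rfl
  map_comp _ _ := rfl

/-- With `1 = ∑ a i * e * b i`, every `m` is `∑ a i • (e • b i • m)`, so a linear map is determined
on `e M`. -/
theorem cornerFunctor_faithful (hfull : IsFullElement e) :
    (cornerFunctor.{w} he).Faithful where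
  map_injective {M N f g} h := by
    obtain ⟨ι, _, a, b, hab⟩ := hfull
    have hfix : ∀ m : M, f.hom (e • m) = g.hom (e • m) := fun m =>
      congrArg Subtype.val (LinearMap.congr_fun (congrArg ModuleCat.Hom.hom h)
        ⟨e • m, smul_mem_fixed he m⟩)
    ext m
    rw [← one_smul R m, ← hab, Finset.sum_smul, map_sum, map_sum]
    refine Finset.sum_congr rfl fun i _ => ?_
    rw [mul_smul, mul_smul]
    exact (f.hom.map_smul _ _).trans ((congrArg _ (hfix _)).trans (g.hom.map_smul _ _).symm)

theorem cornerFunctor_full (hfull : IsFullElement e) :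
    (cornerFunctor.{w} he).Full where
  map_surjective {M N} g := by
    obtain ⟨ι, _, a, b, hab⟩ := hfull
    let g' : fixed e M →ₗ[he.Corner] fixed e N := g.hom
    -- The extension of `g` has to be `f m = ∑ a i • g (e • b i • m)`. The auxiliary map `γ m = g (e
    -- • m)` expresses this formula, and `hkey` gives its behaviour under scalars, from which
    -- linearity of `f` follows.
    let γ : M → N := fun m => (g' ⟨e • m, smul_mem_fixed he m⟩).1
    have hγadd : ∀ m n, γ (m + n) = γ m + γ n := fun m n => by
      have h : (⟨e • (m + n), smul_mem_fixed he _⟩ : fixed e M) =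
          ⟨e • m, smul_mem_fixed he m⟩ + ⟨e • n, smul_mem_fixed he n⟩ :=
        Subtype.ext (smul_add e m n)
      show (g' _).1 = _
      rw [h, map_add]
      rfl
    have hγsmul : ∀ (r : R) (m : M), γ ((r * e) • m) = (e * r * e) • γ m := fun r m => by
      have h : (⟨e • (r * e) • m, smul_mem_fixed he _⟩ : fixed e M) =
          Corner.mk he r • ⟨e • m, smul_mem_fixed he m⟩ :=
        Subtype.ext (by
          rw [coe_corner_smul, Corner.coe_mk]
          simp only [smul_smul, mul_assoc, he.eq])
      show (g' _).1 = _
      rw [h, map_smul]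
      rfl
    have hγe : ∀ m, e • γ m = γ m := fun m => (g' _).2
    let Γ : M →+ N := ⟨⟨γ, by simpa using hγadd 0 0⟩, hγadd⟩
    have hΓ : ∀ m, Γ m = γ m := fun _ => rfl
    have hexp : ∀ m : M, m = ∑ i, (a i * e * b i) • m := fun m => by
      rw [← Finset.sum_smul, hab, one_smul]
    have hkey : ∀ (r : R) (m : M), Γ (r • m) = ∑ i, (e * r * a i * e) • Γ (b i • m) := by
      intro r m
      conv_lhs => rw [hexp m, Finset.smul_sum, map_sum]
      refine Finset.sum_congr rfl fun i _ => ?_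
      have h : r • (a i * e * b i) • m = ((r * a i) * e) • b i • m := by
        simp only [smul_smul, mul_assoc]
      rw [h, hΓ, hγsmul, hΓ]
      simp only [mul_assoc]
    have hΓe : ∀ (r : R) (m : M), (r * e) • Γ m = r • Γ m := fun r m => by
      rw [mul_smul, hΓ, hγe]
    let f : M →ₗ[R] N :=
      { toFun := fun m => ∑ i, a i • Γ (b i • m)
        map_add' := fun m n => by simp only [smul_add, map_add, Finset.sum_add_distrib]
        map_smul' := fun r m => by
          have h : ∀ i, a i • Γ (b i • r • m) =
              ∑ j, (a i * (e * (b i * r) * a j * e)) • Γ (b j • m) := fun i => by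
            rw [← mul_smul, hkey, Finset.smul_sum]
            exact Finset.sum_congr rfl fun j _ => (mul_smul _ _ _).symm
          rw [RingHom.id_apply, Finset.sum_congr rfl fun i _ => h i, Finset.sum_comm,
            Finset.smul_sum]
          refine Finset.sum_congr rfl fun j _ => ?_
          rw [← Finset.sum_smul, smul_smul, ← hΓe (r * a j)]
          congr 1
          calc ∑ i, a i * (e * (b i * r) * a j * e)
              = (∑ i, a i * e * b i) * (r * a j * e) := by
                rw [Finset.sum_mul]
                simp only [mul_assoc]
            _ = r * a j * e := by rw [hab, one_mul] }
    refine ⟨ModuleCat.ofHom f, ModuleCat.hom_ext (LinearMap.ext fun m => Subtype.ext ?_)⟩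
    have hm : e • m.1 = m.1 := m.2
    calc f m.1 = e • f m.1 := by rw [← map_smul, hm]
      _ = ∑ i, (e * 1 * a i * e) • Γ (b i • m.1) := by
        show e • ∑ i, a i • Γ (b i • m.1) = _
        rw [Finset.smul_sum]
        exact Finset.sum_congr rfl fun i _ => by rw [mul_one, hΓe, mul_smul]
      _ = Γ m.1 := by rw [← hkey, one_smul]
      _ = (g' m).1 := congrArg (fun x => (g' x).1) (Subtype.ext hm)

variable (N : Type*) [AddCommGroup N] [Module he.Corner N]

/-- The module coinduced from the corner of `e`. -/
def Coinduced : AddSubgroup (R →+ N) where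
  carrier := {φ | ∀ (c : he.Corner) (x : R), φ (c.1 * x) = c • φ x}
  add_mem' {φ ψ} hφ hψ c x := by
    rw [AddMonoidHom.add_apply, AddMonoidHom.add_apply, hφ, hψ, smul_add]
  zero_mem' c x := (smul_zero c).symm
  neg_mem' {φ} hφ c x := by
    rw [AddMonoidHom.neg_apply, AddMonoidHom.neg_apply, hφ, smul_neg]

instance : SMul R (Coinduced he N) where
  smul r φ := ⟨φ.1.comp (AddMonoidHom.mulRight r), fun c x => by
    show φ.1 (c.1 * x * r) = c • φ.1 (x * r)
    rw [mul_assoc, φ.2]⟩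

variable {N} in
theorem Coinduced.smul_apply (r x : R) (φ : Coinduced he N) : (r • φ).1 x = φ.1 (x * r) := rfl

instance : Module R (Coinduced he N) where
  one_smul φ := Subtype.ext (AddMonoidHom.ext fun x => congrArg φ.1 (mul_one x))
  mul_smul r s φ := Subtype.ext (AddMonoidHom.ext fun x => congrArg φ.1 (mul_assoc x r s).symm)
  smul_zero r := rfl
  smul_add r φ ψ := rfl
  add_smul r s φ := Subtype.ext (AddMonoidHom.ext fun x => by
    show φ.1 (x * (r + s)) = φ.1 (x * r) + φ.1 (x * s)
    rw [mul_add, map_add])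
  zero_smul φ := Subtype.ext (AddMonoidHom.ext fun x => by
    show φ.1 (x * 0) = 0
    rw [mul_zero, map_zero])

/-- The elements of the coinduced module fixed by `e` form the given module. -/
def fixedCoinducedEquiv : fixed e (Coinduced he N) ≃ₗ[he.Corner] N where
  toFun φ := φ.1.1 1
  map_add' _ _ := rfl
  map_smul' c φ := by
    show φ.1.1 (1 * c.1) = c • φ.1.1 1
    rw [one_mul, ← φ.1.2, mul_one]
  invFun n := ⟨⟨{ toFun := fun x => Corner.mk he x • n
                  map_zero' := by
                    have h : Corner.mk he 0 = 0 := Corner.ext (by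
                      rw [Corner.coe_mk, mul_zero, zero_mul, Corner.coe_zero])
                    rw [h]
                    exact zero_smul he.Corner n
                  map_add' := fun x y => by
                    have h : Corner.mk he (x + y) = Corner.mk he x + Corner.mk he y :=
                      Corner.ext (by
                        rw [Corner.coe_add, Corner.coe_mk, Corner.coe_mk, Corner.coe_mk, mul_add,
                          add_mul])
                    rw [h, add_smul] }, fun c x => by
      have h : Corner.mk he (c.1 * x) = c * Corner.mk he x := Corner.ext (by
        rw [Corner.coe_mul, Corner.coe_mk, Corner.coe_mk, ← mul_assoc e c.1, Corner.mul_coe,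
          ← mul_assoc, ← mul_assoc, Corner.coe_mul_idem])
      show Corner.mk he (c.1 * x) • n = c • Corner.mk he x • n
      rw [h, mul_smul]⟩, Subtype.ext (AddMonoidHom.ext fun x => by
      have h : Corner.mk he (x * e) = Corner.mk he x := Corner.ext (by
        rw [Corner.coe_mk, Corner.coe_mk, ← mul_assoc, mul_assoc (e * x), he.eq])
      show Corner.mk he (x * e) • n = Corner.mk he x • n
      rw [h])⟩
  left_inv φ := by
    refine Subtype.ext (Subtype.ext (AddMonoidHom.ext fun x => ?_))
    have h : ∀ x, φ.1.1 (x * e) = φ.1.1 x := fun x =>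
      DFunLike.congr_fun (congrArg Subtype.val (show e • φ.1 = φ.1 from φ.2)) x
    have h' : φ.1.1 (e * x) = φ.1.1 x := by
      have := φ.1.2 1 x
      rwa [one_smul] at this
    show Corner.mk he x • φ.1.1 1 = φ.1.1 x
    rw [← φ.1.2, mul_one, Corner.coe_mk, h, h']
  right_inv n := by
    have h : Corner.mk he 1 = 1 := Corner.ext (by
      rw [Corner.coe_mk, mul_one, he.eq, Corner.coe_one])
    show Corner.mk he 1 • n = n
    rw [h, one_smul]

end Functor

open CategoryTheory

/-- The preimage of `N` is `Hom(e R, N)` over the corner, written as maps on `R`: the case `c = 1`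
of the defining condition gives `φ (e * x) = φ x`. Evaluation at `1` recovers `N`. Fullness of `e`
plays no role. -/
theorem cornerFunctor_essSurj {R : Type v} [Ring R] {e : R} (he : IsIdempotentElem e) :
    (cornerFunctor.{max v w} he).EssSurj where
  mem_essImage N := ⟨ModuleCat.of R (Coinduced he N), ⟨(fixedCoinducedEquiv he N).toModuleIso⟩⟩

open scoped ModuleCat.Algebra in
/-- A ring is Morita equivalent to the corner of a full idempotent. -/
theorem isMoritaEquivalent_corner {K : Type*} [Field K] {R : Type v} [Ring R] [Algebra K R]
    {e : R} (he : IsIdempotentElem e) (hfull : IsFullElement e) :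
    IsMoritaEquivalent K R he.Corner := by
  have := cornerFunctor_faithful.{v} he hfull
  have := cornerFunctor_full.{v} he hfull
  have := cornerFunctor_essSurj.{v, v} he
  have : (cornerFunctor.{v} he).IsEquivalence := { }
  refine ⟨⟨(cornerFunctor.{v} he).asEquivalence, ⟨?_⟩⟩⟩
  intro M N f k
  refine ModuleCat.hom_ext (LinearMap.ext fun m => Subtype.ext ?_)
  show algebraMap K R k • f.hom m.1 = (algebraMap K he.Corner k).1 • f.hom m.1
  have hm : e • m.1 = m.1 := m.2
  rw [Corner.coe_algebraMap, Algebra.algebraMap_eq_smul_one, ← hm, map_smul, smul_smul, smul_smul,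
    smul_mul_assoc, smul_mul_assoc, one_mul, he.eq]

end IsIdempotentElem

open CategoryTheory

/-! ### Equivalences take the regular module to a progenerator -/

namespace ModuleCat

variable {A : Type u} [Ring A] {S : Type v} [Ring S]

/-- The map from the free module of rank one given by an element. -/
def elementMap (P : ModuleCat.{max u v} S) (p : P) :
    ModuleCat.of S (ULift.{u} S) ⟶ P :=
  ModuleCat.ofHom ((LinearMap.toSpanSingleton S P p).comp ULift.moduleEquiv.toLinearMap)

theorem elementMap_comp_eq_zero_iff {P T : ModuleCat.{max u v} S} (p : P) (f : P ⟶ T) :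
    elementMap P p ≫ f = 0 ↔ f.hom p = 0 := by
  constructor
  · intro h
    have := LinearMap.congr_fun (congrArg ModuleCat.Hom.hom h) (ULift.up (1 : S))
    have h' : f.hom ((1 : S) • p) = 0 := this
    rwa [one_smul] at h'
  · intro h
    ext x
    show f.hom (x.down • p) = 0
    rw [map_smul, h, smul_zero]

theorem projective_functor_obj (E : ModuleCat.{max u v} A ≌ ModuleCat.{max u v} S) :
    Module.Projective S (E.functor.obj (ModuleCat.of A (ULift.{v} A))) := by
  have : Module.Projective A (ULift.{v} A) := .of_equiv ULift.moduleEquiv.symm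
  have : Projective (ModuleCat.of A (ULift.{v} A)) := inferInstance
  have : Projective (E.functor.obj (ModuleCat.of A (ULift.{v} A))) :=
    (E.map_projective_iff _).2 this
  infer_instance

variable (E : ModuleCat.{max u v} A ≌ ModuleCat.{max u v} S) [E.functor.Additive]

theorem homEquiv_symm_comp_eq_zero_iff {X : ModuleCat.{max u v} S}
    {M N : ModuleCat.{max u v} A} (φ : X ⟶ E.functor.obj M) (g : M ⟶ N) :
    (E.symm.toAdjunction.homEquiv X M).symm φ ≫ g = 0 ↔ φ ≫ E.functor.map g = 0 := by
  rw [← (E.symm.toAdjunction.homEquiv X N).apply_eq_iff_eq,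
    Adjunction.homEquiv_naturality_right, Equiv.apply_symm_apply, Adjunction.homEquiv_unit]
  have h : E.symm.inverse.map (0 : E.symm.functor.obj X ⟶ N) = 0 := E.functor.map_zero _ _
  rw [h, Limits.comp_zero]
  rfl

/-- Finite generation means that the top submodule is compact. Elements `p` of `E M` correspond to
maps `ψ p` into `M` whose images cover `M`; finitely many images suffice, and the corresponding
elements generate `E M`. -/
theorem finite_functor_obj (M : ModuleCat.{max u v} A) [Module.Finite A M] :
    Module.Finite S (E.functor.obj M) := by
  let P := E.functor.obj M
  let ψ : ∀ p : P, E.inverse.obj (ModuleCat.of S (ULift.{u} S)) ⟶ M := fun p =>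
    (E.symm.toAdjunction.homEquiv _ M).symm (elementMap P p)
  have hψ : ∀ (p : P) {N : ModuleCat.{max u v} A} (g : M ⟶ N),
      ψ p ≫ g = 0 ↔ (E.functor.map g).hom p = 0 := fun p N g =>
    (homEquiv_symm_comp_eq_zero_iff E _ g).trans (elementMap_comp_eq_zero_iff p _)
  have hsup : ⨆ p : P, LinearMap.range (ψ p).hom = ⊤ := by
    let J := ⨆ p : P, LinearMap.range (ψ p).hom
    let q : M ⟶ ModuleCat.of A (M ⧸ J) := ModuleCat.ofHom J.mkQ
    have hq : E.functor.map q = 0 := by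
      ext p
      refine (hψ p q).1 ?_
      ext x
      exact (Submodule.Quotient.mk_eq_zero J).2
        (Submodule.mem_iSup_of_mem p (LinearMap.mem_range_self _ x))
    have hq' : q = 0 := E.functor.map_injective (hq.trans (E.functor.map_zero _ _).symm)
    rw [← Submodule.ker_mkQ (⨆ p : P, LinearMap.range (ψ p).hom)]
    exact LinearMap.ker_eq_top.2 (congrArg ModuleCat.Hom.hom hq')
  obtain ⟨t, ht⟩ := CompleteLattice.isCompactElement_iff_exists_le_iSup_of_le_iSup _ |>.1
    ((Submodule.fg_iff_compact _).1 (Module.Finite.fg_top (R := A) (M := M))) _ _ hsup.ge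
  refine ⟨⟨t, ?_⟩⟩
  let N := Submodule.span S (t : Set P)
  let q : P ⟶ ModuleCat.of S (P ⧸ N) := ModuleCat.ofHom N.mkQ
  -- The quotient map of `E M` by the span of the chosen elements comes from a map `r` out of `M`.
  -- It kills the images of the chosen `ψ p`, which cover `M`, so `r` and the quotient map vanish.
  obtain ⟨r, hr⟩ := E.functor.map_surjective (q ≫ E.counitInv.app _)
  have hr₀ : r = 0 := by
    have hle : ⊤ ≤ LinearMap.ker r.hom := by
      refine ht.trans (Finset.sup_le fun p hp => ?_)
      rintro _ ⟨x, rfl⟩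
      have h : ψ p ≫ r = 0 := (hψ p r).2 (by
        rw [hr]
        have : q.hom p = 0 := (Submodule.Quotient.mk_eq_zero N).2 (Submodule.subset_span hp)
        show (E.counitInv.app _).hom (q.hom p) = 0
        rw [this, map_zero])
      exact LinearMap.congr_fun (congrArg ModuleCat.Hom.hom h) x
    ext x
    exact hle (Submodule.mem_top (x := x))
  have hq : q = 0 := by
    rw [hr₀, E.functor.map_zero] at hr
    have h := congrArg (q ≫ ·) (E.counitIso.inv_hom_id_app (ModuleCat.of S (P ⧸ N)))
    refine (Category.comp_id q).symm.trans (h.symm.trans ?_)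
    exact (Category.assoc q _ _).symm.trans
      ((congrArg (· ≫ E.counitIso.hom.app _) hr.symm).trans Limits.zero_comp)
  have : N.mkQ = 0 := congrArg ModuleCat.Hom.hom hq
  rw [← Submodule.ker_mkQ (Submodule.span S (t : Set P))]
  exact LinearMap.ker_eq_top.2 this

/-- The functor of an equivalence takes the free module of rank one to a generator. -/
theorem exists_sum_eq_one_functor_obj :
    ∃ (n : ℕ) (φ : Fin n → (E.functor.obj (ModuleCat.of A (ULift.{v} A)) →ₗ[S] S))
      (p : Fin n → E.functor.obj (ModuleCat.of A (ULift.{v} A))), ∑ i, φ i (p i) = 1 := by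
  let P := E.functor.obj (ModuleCat.of A (ULift.{v} A))
  have := projective_functor_obj E
  -- `T` is the trace ideal of `P`. By projectivity, a map `P → S ⧸ T` lifts to `S`, where its
  -- values lie in `T`, so it is zero. As `P` corresponds to the regular module, `S ⧸ T` corresponds
  -- to a module without nonzero elements, and `T = S`.
  let T : Submodule S S := Submodule.span S {x | ∃ (φ : P →ₗ[S] S) (p : P), φ p = x}
  let X : ModuleCat.{max u v} S := ModuleCat.of S (ULift.{u} (S ⧸ T))
  have hP : ∀ g : P ⟶ X, g = 0 := by
    intro g
    obtain ⟨h, hh⟩ := Module.projective_lifting_property T.mkQ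
      (ULift.moduleEquiv.toLinearMap.comp g.hom) T.mkQ_surjective
    refine ModuleCat.hom_ext (LinearMap.ext fun p => ?_)
    refine (ULift.moduleEquiv (R := S) (M := S ⧸ T)).injective
      ((LinearMap.congr_fun hh p).symm.trans ?_)
    exact (Submodule.Quotient.mk_eq_zero T).2 (Submodule.subset_span ⟨h, p, rfl⟩)
  have hY : ∀ y : E.inverse.obj X, y = 0 := by
    intro y
    have h : E.functor.map (elementMap (E.inverse.obj X) y) = 0 := by
      have h := congrArg (· ≫ E.counitIso.inv.app X)
        (hP (E.functor.map (elementMap (E.inverse.obj X) y) ≫ E.counitIso.hom.app X))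
      simpa using h
    have h' : elementMap (E.inverse.obj X) y = 0 :=
      E.functor.map_injective (h.trans (E.functor.map_zero _ _).symm)
    refine (elementMap_comp_eq_zero_iff y (𝟙 _)).1 ?_
    rw [h', Limits.zero_comp]
  have hX : 𝟙 X = 0 := by
    have h : 𝟙 (E.inverse.obj X) = 0 := ModuleCat.hom_ext (LinearMap.ext fun y => by
      rw [hY y, map_zero, map_zero])
    have h' : 𝟙 (E.functor.obj (E.inverse.obj X)) = 0 := by
      rw [← E.functor.map_id, h, E.functor.map_zero]
    have h₁ := E.counitIso.inv_hom_id_app X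
    rw [← Category.id_comp (E.counitIso.hom.app X)] at h₁
    erw [h'] at h₁
    rw [Limits.zero_comp, Limits.comp_zero] at h₁
    exact h₁.symm
  have h1 : (1 : S) ∈ T := by
    rw [← Submodule.Quotient.mk_eq_zero]
    exact congrArg ULift.down (LinearMap.congr_fun (congrArg ModuleCat.Hom.hom hX)
      (ULift.up (Submodule.Quotient.mk 1)))
  obtain ⟨n, f, g, hfg⟩ := (Submodule.mem_span_set' (R := S)).1 h1
  choose φ p hφ using fun i => (g i).2
  refine ⟨n, φ, fun i => f i • p i, ?_⟩
  rw [← hfg]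
  exact Finset.sum_congr rfl fun i _ => by rw [map_smul, hφ]

end ModuleCat

/-! ### Morita equivalent algebras as full corners of matrix algebras -/

section FullCorner

variable {A : Type u} [Ring A]

theorem ModuleCat.elementMap_mul (a b : A) :
    elementMap (ModuleCat.of A (ULift.{v} A)) (ULift.up (a * b)) =
      elementMap (ModuleCat.of A (ULift.{v} A)) (ULift.up a) ≫
        elementMap (ModuleCat.of A (ULift.{v} A)) (ULift.up b) := by
  ext x
  exact (mul_assoc x.down a b).symm

theorem ModuleCat.elementMap_one :
    elementMap (ModuleCat.of A (ULift.{v} A)) (ULift.up 1) = 𝟙 _ := by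
  ext x
  exact mul_one x.down

theorem ModuleCat.elementMap_add {S : Type v} [Ring S] (P : ModuleCat.{max u v} S) (p q : P) :
    elementMap P (p + q) = elementMap P p + elementMap P q := by
  ext x
  exact smul_add x.down p q

theorem ModuleCat.elementMap_bijective :
    Function.Bijective fun a : A => elementMap (ModuleCat.of A (ULift.{v} A)) (ULift.up a) := by
  constructor
  · intro a b h
    have h' := LinearMap.congr_fun (congrArg ModuleCat.Hom.hom h) (ULift.up 1)
    have h'' : (1 : A) * a = 1 * b := congrArg ULift.down h'
    rwa [one_mul, one_mul] at h''
  · intro f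
    refine ⟨(f.hom (ULift.up 1)).down, ModuleCat.hom_ext (LinearMap.ext fun x => ?_)⟩
    have h : x = x.down • (ULift.up 1 : ULift.{v} A) := congrArg ULift.up (mul_one x.down).symm
    have h' := congrArg f.hom h
    rw [map_smul] at h'
    exact h'.symm

open scoped ModuleCat.Algebra in
/-- An algebra Morita equivalent to `S` is a full corner of a matrix algebra over `S`. -/
theorem IsMoritaEquivalent.exists_algEquiv_corner {K : Type w} [Field K] [Algebra K A]
    {S : Type v} [Ring S] [Algebra K S] (h : IsMoritaEquivalent K A S) :
    ∃ (n : ℕ) (e : Matrix (Fin (n + 1)) (Fin (n + 1)) S) (he : IsIdempotentElem e),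
      IsFullElement e ∧ Nonempty (A ≃ₐ[K] he.Corner) := by
  obtain ⟨⟨E⟩⟩ := h
  let F := E.eqv.functor
  have : F.Additive := inferInstanceAs E.eqv.functor.Additive
  let L : ModuleCat.{max u v} A := ModuleCat.of A (ULift.{v} A)
  let P : ModuleCat.{max u v} S := F.obj L
  have : Module.Finite A L := Module.Finite.equiv (ULift.moduleEquiv (R := A) (M := A)).symm
  have : Module.Finite S P := ModuleCat.finite_functor_obj E.eqv L
  have : Module.Projective S P := ModuleCat.projective_functor_obj E.eqv
  obtain ⟨m, φ, p, hφp⟩ := ModuleCat.exists_sum_eq_one_functor_obj E.eqv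
  obtain ⟨n, π₀, hπ₀⟩ := Module.Finite.exists_fin' S P
  -- The extra coordinate, which `π` ignores, keeps the index set of the matrices nonempty.
  let π : (Fin (n + 1) → S) →ₗ[S] P := π₀ ∘ₗ LinearMap.funLeft S S Fin.castSucc
  have hπ : Function.Surjective π :=
    hπ₀.comp (LinearMap.funLeft_surjective_of_injective S S _ (Fin.castSucc_injective n))
  obtain ⟨s, hs⟩ := Module.projective_lifting_property π LinearMap.id hπ
  have hs' : ∀ x, π (s x) = x := fun x => LinearMap.congr_fun hs x
  -- `P` is a summand of a free module, and `μ` identifies its endomorphisms with the corner at `e =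
  -- μ id`. Matrices act on row vectors, so `μ` reverses composition. So does `θ` below, given by
  -- right multiplications, and the composite is a homomorphism.
  let μ : (P →ₗ[S] P) → Matrix (Fin (n + 1)) (Fin (n + 1)) S := fun f =>
    (s ∘ₗ f ∘ₗ π).toMatrixRight'
  have hμmul : ∀ f g, μ (g ∘ₗ f) = μ f * μ g := by
    intro f g
    rw [← LinearMap.toMatrixRight'_comp]
    refine congrArg LinearMap.toMatrixRight' (LinearMap.ext fun x => ?_)
    simp only [LinearMap.comp_apply, hs']
  have hμadd : ∀ f g, μ (f + g) = μ f + μ g := by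
    intro f g
    refine Eq.trans ?_ (map_add LinearMap.toMatrixRight' _ _)
    refine congrArg LinearMap.toMatrixRight' (LinearMap.ext fun x => ?_)
    simp only [LinearMap.comp_apply, LinearMap.add_apply, map_add]
  have hμinj : Function.Injective μ := by
    intro f g h
    refine LinearMap.ext fun x => ?_
    have h' := LinearMap.congr_fun (LinearMap.toMatrixRight'.injective h) (s x)
    simp only [LinearMap.comp_apply, hs'] at h'
    rw [← hs' (f x), h', hs']
  let e := μ LinearMap.id
  have he : IsIdempotentElem e := (hμmul _ _).symm
  have hμe : ∀ f, e * μ f * e = μ f := fun f => by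
    rw [← hμmul, ← hμmul]
    rfl
  have hμsurj : ∀ X : he.Corner, ∃ f, μ f = X.1 := by
    intro X
    refine ⟨π ∘ₗ X.1.toLinearMapRight' ∘ₗ s, ?_⟩
    have h : s ∘ₗ (π ∘ₗ X.1.toLinearMapRight' ∘ₗ s) ∘ₗ π =
        (s ∘ₗ LinearMap.id ∘ₗ π) ∘ₗ X.1.toLinearMapRight' ∘ₗ s ∘ₗ LinearMap.id ∘ₗ π := rfl
    show LinearMap.toMatrixRight' _ = _
    rw [h, LinearMap.toMatrixRight'_comp, LinearMap.toMatrixRight'_comp]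
    have hX : LinearMap.toMatrixRight' X.1.toLinearMapRight' = X.1 :=
      LinearMap.toMatrixRight'.apply_symm_apply _
    rw [hX]
    show e * X.1 * e = X.1
    rw [IsIdempotentElem.Corner.mul_coe, IsIdempotentElem.Corner.coe_mul_idem]
  let θ : A → (P →ₗ[S] P) := fun a => (F.map (ModuleCat.elementMap L (ULift.up a))).hom
  have hθmul : ∀ a b, θ (a * b) = θ b ∘ₗ θ a := fun a b =>
    congrArg ModuleCat.Hom.hom ((congrArg F.map (ModuleCat.elementMap_mul a b)).trans
      (F.map_comp _ _))
  have hθone : θ 1 = LinearMap.id :=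
    congrArg ModuleCat.Hom.hom ((congrArg F.map ModuleCat.elementMap_one).trans (F.map_id _))
  have hθadd : ∀ a b, θ (a + b) = θ a + θ b := fun a b =>
    congrArg ModuleCat.Hom.hom ((congrArg F.map
      (ModuleCat.elementMap_add L (ULift.up a) (ULift.up b))).trans F.map_add)
  have hθalg : ∀ (k : K) (x : P), θ (algebraMap K A k) x = algebraMap K S k • x := by
    intro k x
    have h := (F.map_smul k (𝟙 L)).trans (congrArg (k • ·) (F.map_id L))
    refine LinearMap.congr_fun (congrArg ModuleCat.Hom.hom ((congrArg F.map ?_).trans h)) x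
    refine ModuleCat.hom_ext (LinearMap.ext fun y => ULift.ext _ _ ?_)
    exact (Algebra.commutes k y.down).symm
  have hθbij : Function.Bijective θ :=
    ModuleCat.homEquiv.bijective.comp
      (Function.Bijective.comp (g := F.map (X := L) (Y := L))
        ⟨F.map_injective, F.map_surjective⟩ ModuleCat.elementMap_bijective)
  let ρ : A →ₐ[K] he.Corner :=
    { toFun := fun a => ⟨μ (θ a), μ (θ a), hμe _⟩
      map_one' := Subtype.ext (congrArg μ hθone)
      map_mul' := fun a b => Subtype.ext ((congrArg μ (hθmul a b)).trans (hμmul _ _))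
      map_zero' := Subtype.ext (by
        have h := hμadd (θ 0) (θ 0)
        rw [← hθadd, add_zero, left_eq_add] at h
        exact h)
      map_add' := fun a b => Subtype.ext ((congrArg μ (hθadd a b)).trans (hμadd _ _))
      commutes' := fun k => Subtype.ext (by
        rw [IsIdempotentElem.Corner.coe_algebraMap]
        ext i j
        show s (θ (algebraMap K A k) (π (Pi.single i 1))) j = k • s (π (Pi.single i 1)) j
        rw [hθalg, map_smul, Pi.smul_apply, smul_eq_mul, ← Algebra.smul_def]) }
  refine ⟨n, e, he, ?_, ⟨AlgEquiv.ofBijective ρ ⟨fun a b h => ?_, fun X => ?_⟩⟩⟩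
  -- For the pair `(j, k)` the product is `x ↦ x j * φ k (p k)` placed in coordinate `j`. Since `∑ φ
  -- k (p k) = 1`, these sum to the identity.
  · refine ⟨Fin (n + 1) × Fin m, inferInstance,
      fun i => (s ∘ₗ LinearMap.toSpanSingleton S P (p i.2) ∘ₗ
        LinearMap.proj i.1).toMatrixRight',
      fun i => (LinearMap.single S (fun _ => S) i.1 ∘ₗ φ i.2 ∘ₗ π).toMatrixRight', ?_⟩
    have h : ∀ i : Fin (n + 1) × Fin m,
        (s ∘ₗ LinearMap.toSpanSingleton S P (p i.2) ∘ₗ LinearMap.proj i.1).toMatrixRight' * e *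
          (LinearMap.single S (fun _ => S) i.1 ∘ₗ φ i.2 ∘ₗ π).toMatrixRight' =
        (LinearMap.single S (fun _ => S) i.1 ∘ₗ φ i.2 ∘ₗ
          LinearMap.toSpanSingleton S P (p i.2) ∘ₗ LinearMap.proj i.1).toMatrixRight' := by
      intro i
      rw [← LinearMap.toMatrixRight'_comp, ← LinearMap.toMatrixRight'_comp]
      refine congrArg LinearMap.toMatrixRight' (LinearMap.ext fun x => ?_)
      simp only [LinearMap.comp_apply, LinearMap.id_apply, hs']
    rw [Finset.sum_congr rfl fun i _ => h i, ← map_sum, ← LinearMap.toMatrixRight'_id]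
    refine congrArg LinearMap.toMatrixRight' (LinearMap.ext fun x => ?_)
    rw [LinearMap.sum_apply, Fintype.sum_prod_type]
    simp only [LinearMap.comp_apply, LinearMap.toSpanSingleton_apply, LinearMap.proj_apply,
      ← map_sum, map_smul, ← Finset.smul_sum, hφp, LinearMap.id_apply]
    ext j
    simp [Finset.sum_apply, Pi.single_apply]
  · exact hθbij.1 (hμinj (congrArg Subtype.val h))
  · obtain ⟨f, hf⟩ := hμsurj X
    obtain ⟨a, rfl⟩ := hθbij.2 f
    exact ⟨a, Subtype.ext hf⟩

end FullCorner

/-! ### Indecomposability and lifting along Morita equivalences -/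

theorem IsIndecomposableRing.of_ringEquiv {A : Type*} {B : Type*} [Ring A] [Ring B] (f : A ≃+* B)
    (hA : IsIndecomposableRing A) : IsIndecomposableRing B := by
  have := hA.1
  refine ⟨f.symm.toEquiv.nontrivial, fun e he he' => ?_⟩
  have h := hA.2 (f.symm e) (Subring.mem_center_iff.2 fun x => f.injective (by
    rw [map_mul, map_mul, f.apply_symm_apply]
    exact Subring.mem_center_iff.1 he (f x))) (by
    rw [IsIdempotentElem, ← map_mul, he'.eq])
  rwa [EmbeddingLike.map_eq_zero_iff, EmbeddingLike.map_eq_one_iff] at h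

/-- Multiplication by a full idempotent `e` is injective on the centre: if `e * y = 0`, then `y = ∑
a i * e * y * b i = 0`. It sends central idempotents to central idempotents of the corner. -/
theorem IsIndecomposableRing.of_fullCorner {R : Type*} [Ring R] {e : R} (he : IsIdempotentElem e)
    (hfull : IsFullElement e) (h : IsIndecomposableRing he.Corner) : IsIndecomposableRing R := by
  have hnt := h.1
  refine ⟨nontrivial_iff.2 ?_, fun z hz hz' => ?_⟩
  · obtain ⟨x, y, hxy⟩ := exists_pair_ne he.Corner
    exact ⟨x.1, y.1, fun h => hxy (IsIdempotentElem.Corner.ext h)⟩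
  obtain ⟨ι, _, a, b, hab⟩ := hfull
  have hcomm : ∀ x, x * z = z * x := Subring.mem_center_iff.1 hz
  have hzero : ∀ y : R, (∀ x, x * y = y * x) → e * y = 0 → y = 0 := by
    intro y hy hey
    rw [← one_mul y, ← hab, Finset.sum_mul]
    refine Finset.sum_eq_zero fun i _ => ?_
    rw [mul_assoc, hy, ← mul_assoc, mul_assoc (a i), hey, mul_zero, zero_mul]
  have hez : e * z * e = e * z := by rw [mul_assoc, ← hcomm, ← mul_assoc, he.eq]
  rcases h.2 (IsIdempotentElem.Corner.mk he z)
    (Subring.mem_center_iff.2 fun x => IsIdempotentElem.Corner.ext (by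
      rw [IsIdempotentElem.Corner.coe_mul, IsIdempotentElem.Corner.coe_mul,
        IsIdempotentElem.Corner.coe_mk, hez, ← mul_assoc, IsIdempotentElem.Corner.coe_mul_idem,
        mul_assoc, ← hcomm, ← mul_assoc, IsIdempotentElem.Corner.mul_coe]))
    (IsIdempotentElem.Corner.ext (by
      rw [IsIdempotentElem.Corner.coe_mul, IsIdempotentElem.Corner.coe_mk, hez, ← mul_assoc, hez,
        mul_assoc, hz'.eq])) with h0 | h1
  · left
    refine hzero z hcomm ?_
    rw [← hez]
    exact congrArg Subtype.val h0
  · right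
    have h1' : e * z = e := by
      rw [← hez]
      exact congrArg Subtype.val h1
    refine (sub_eq_zero.1 (hzero (1 - z) (fun x => ?_) ?_)).symm
    · rw [mul_sub, sub_mul, hcomm, one_mul, mul_one]
    · rw [mul_sub, h1', mul_one, sub_self]

/-- A central idempotent gives a central idempotent scalar matrix; the entry at `(0, 0)` recovers
it. -/
theorem IsIndecomposableRing.of_matrix {S : Type*} [Ring S] {n : ℕ}
    (h : IsIndecomposableRing (Matrix (Fin (n + 1)) (Fin (n + 1)) S)) :
    IsIndecomposableRing S := by
  have hnt := h.1
  refine ⟨?_, fun z hz hz' => ?_⟩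
  · by_contra hS
    rw [not_nontrivial_iff_subsingleton] at hS
    exact not_subsingleton (Matrix (Fin (n + 1)) (Fin (n + 1)) S) inferInstance
  have hentry := fun (x : S) => congrFun (congrFun (Matrix.scalar_apply (n := Fin (n + 1)) x) 0) 0
  simp only [Matrix.diagonal_apply_eq] at hentry
  rcases h.2 (Matrix.scalar (Fin (n + 1)) z)
    (Subring.mem_center_iff.2 fun x =>
      (Matrix.scalar_commute z (fun r => (Subring.mem_center_iff.1 hz r).symm) x).eq.symm)
    (by rw [IsIdempotentElem, ← map_mul, hz'.eq]) with h0 | h1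
  · left
    rw [← hentry z, h0, Matrix.zero_apply]
  · right
    rw [← hentry z, h1, Matrix.one_apply_eq]

/-- The entries of `X ^ n` lie in the `n`-th power of the kernel. A nilpotent kernel, not merely a
nil one, makes this argument work. -/
theorem isNilpotent_of_mem_ker_mapMatrix {K : Type*} [CommRing K] {R S : Type*} [Ring R] [Ring S]
    [Algebra K R] [Algebra K S] (f : R →ₐ[K] S) {k : ℕ} (hf : RingHom.ker f ^ k = ⊥)
    {ι : Type*} [Fintype ι] [DecidableEq ι] {X : Matrix ι ι R}
    (hX : X ∈ RingHom.ker (f.mapMatrix : Matrix ι ι R →ₐ[K] Matrix ι ι S)) : IsNilpotent X := by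
  have hX' : ∀ i j, X i j ∈ RingHom.ker f := fun i j => congrFun (congrFun hX i) j
  have h : ∀ (n : ℕ) (i j), (X ^ n) i j ∈ RingHom.ker f ^ n := by
    intro n
    induction n with
    | zero =>
      intro i j
      rw [Submodule.pow_zero, Ideal.one_eq_top]
      trivial
    | succ n ih =>
      intro i j
      rw [pow_succ, Matrix.mul_apply, Submodule.pow_succ]
      exact Submodule.sum_mem _ fun l _ => Ideal.mul_mem_mul (ih i l) (hX' l j)
  refine ⟨k, Matrix.ext fun i j => ?_⟩
  have := h k i j
  rwa [hf] at this

/-- Fullness lifts along surjections with nil kernel. -/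
theorem IsFullElement.of_map {R S : Type*} [Ring R] [Ring S] (f : R →+* S)
    (hf : Function.Surjective f) (hker : ∀ x ∈ RingHom.ker f, IsNilpotent x) {e : R}
    (he : IsFullElement (f e)) : IsFullElement e := by
  obtain ⟨ι, _, a, b, hab⟩ := he
  choose g hg using hf
  -- Lifting the coefficients gives a sum that differs from `1` by a nilpotent element, so it is a
  -- unit and can be divided out.
  have hu : IsUnit (∑ i, g (a i) * e * g (b i)) := by
    rw [← sub_sub_cancel 1 (∑ i, g (a i) * e * g (b i))]
    refine (hker _ ?_).isUnit_one_sub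
    rw [RingHom.mem_ker, map_sub, map_one, map_sum]
    simp only [map_mul, hg, hab, sub_self]
  obtain ⟨u, hu⟩ := hu
  refine ⟨ι, inferInstance, fun i => ↑u⁻¹ * g (a i), fun i => g (b i), ?_⟩
  simp only [mul_assoc, ← Finset.mul_sum]
  simp only [mul_assoc] at hu
  rw [← hu, Units.inv_mul]

/-- A quotient by a nilpotent ideal lifts along a Morita equivalence. -/
theorem IsMoritaEquivalent.exists_surjective {K : Type v} [Field K] {A : Type u} [Ring A]
    [Algebra K A] {R S : Type v} [Ring R] [Ring S] [Algebra K R] [Algebra K S]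
    [Module.Finite K R] (h : IsMoritaEquivalent K A S) (f : R →ₐ[K] S)
    (hf : Function.Surjective f) {k : ℕ} (hk : RingHom.ker f ^ k = ⊥) :
    (IsIndecomposableRing A → IsIndecomposableRing S) ∧
    ∃ (B : Type v) (_ : Ring B) (_ : Algebra K B),
      Module.Finite K B ∧ IsMoritaEquivalent K B R ∧ IsQuotientAlgebra K A B := by
  obtain ⟨n, e, he, hfull, ⟨α⟩⟩ := h.exists_algEquiv_corner
  refine ⟨fun hA => ((hA.of_ringEquiv α.toRingEquiv).of_fullCorner he hfull).of_matrix, ?_⟩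
  let F : Matrix (Fin (n + 1)) (Fin (n + 1)) R →ₐ[K] Matrix (Fin (n + 1)) (Fin (n + 1)) S :=
    f.mapMatrix
  have hF : Function.Surjective F := fun Y => by
    choose g hg using hf
    exact ⟨Y.map g, Matrix.ext fun i j => hg _⟩
  have hker : ∀ x ∈ RingHom.ker F.toRingHom, IsNilpotent x := fun x hx =>
    isNilpotent_of_mem_ker_mapMatrix f hk hx
  -- Idempotents lift modulo a nil ideal; the corner of the lift is the algebra `B`.
  obtain ⟨e', he', rfl⟩ := exists_isIdempotentElem_eq_of_ker_isNilpotent F.toRingHom hker e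
    (hF e) he
  have hfull' : IsFullElement e' := .of_map F.toRingHom hF hker hfull
  refine ⟨he'.Corner, inferInstance, inferInstance, he'.finite_corner,
    ((IsMoritaEquivalent.matrix R K).trans K (he'.isMoritaEquivalent_corner hfull')).symm,
    α.symm.toAlgHom.comp (he'.mapCorner F he rfl),
    α.symm.surjective.comp (he'.mapCorner_surjective F he rfl hF)⟩

theorem mainTheorem3 (K : Type v) [Field K] [IsAlgClosed K] :
    (∀ (Q : Type) [Fintype Q] [Quiver.{0} Q] (I : Ideal (PathAlgebra K Q)) [I.IsTwoSided],
      PathAlgebra.IsSpecialBiserialIdeal I →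
        ∃ G : BrauerGraph,
          (IsIndecomposableRing (PathAlgebra K Q ⧸ I) → G.IsConnected) ∧
          IsQuotientAlgebra K (PathAlgebra K Q ⧸ I) (G.algebra K)) ∧
    (∀ (A : Type u) [Ring A] [Algebra K A], IsSpecialBiserial K A →
        ∃ G : BrauerGraph,
          (IsIndecomposableRing A → G.IsConnected) ∧
          ∃ (B : Type v) (_ : Ring B) (_ : Algebra K B),
            Module.Finite K B ∧ IsMoritaEquivalent K B (G.algebra K) ∧
            IsQuotientAlgebra K A B) := by
  constructor
  · intro Q _ _ I _ hI
    obtain ⟨G, hG, f, hf, -⟩ := hI.exists_brauerGraph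
    exact ⟨G, hG, f, hf⟩
  · rintro A _ _ ⟨-, Q, _, _, I, _, hI, hAI⟩
    obtain ⟨G, hG, f, hf, k, hk⟩ := hI.exists_brauerGraph
    obtain ⟨hindec, hB⟩ := hAI.exists_surjective f hf hk
    exact ⟨G, fun hA => hG (hindec hA), hB⟩

end
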